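/- Let $\mathcal{A}$ be an exact category in the sense of Quillen, i.e. an additive category with a class of kernel--cokernel sequences $A\rightarrowtail B\twoheadrightarrow C$ (the short exact sequences; the first morphism of one is an inflation, the second a deflation) that is closed under isomorphisms and such that identities are inflations and deflations, inflations (resp. deflations) are closed under composition, and pushouts of inflations (resp. pullbacks of deflations) along arbitrary morphisms exist and are inflations (resp. deflations). Let $\operatorname{Ext}^1(A,B)$ be the group of equivalence classes of short exact sequences $B\rightarrowtail E\twoheadrightarrow A$, and for a class $\mathcal{S}$ of objects put $\mathcal{S}^{\perp_1}=\{Y : \operatorname{Ext}^1(S,Y)=0\ \forall S\in\mathcal{S}\}$ and ${}^{\perp_1}\mathcal{S}=\{X : \operatorname{Ext}^1(X,S)=0\ \forall S\in\mathcal{S}\}$. For an ordinal $\lambda>0$, a $\lambda$-sequence of morphisms in a class $\mathcal{D}$ is a functor $X:\lambda\to\mathcal{A}$ with $X_\gamma=\operatorname{colim}_{\alpha<\gamma}X_\alpha$ for all limit ordinals $\gamma<\lambda$ and $X_\alpha\to X_{\alpha+1}$ in $\mathcal{D}$ whenever $\alpha+1<\lambda$; if $\operatorname{colim}_{\alpha<\lambda}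 X_\alpha$ exists, $X_0\to\operatorname{colim}_{\alpha<\lambda} X_\alpha$ is its transfinite composition. Let $I$ be a set of inflations. A relative $I$-cell complex is a transfinite composition of pushouts of morphisms in $I$; $I$-cell is the class of these, and $\mathrm{Cell}(I)$ is the class of objects $A$ with $0\to A$ in $I$-cell. Let $\mathrm{Cok}\,I$ be the class of objects that are cokernels of morphisms in $I$. For a class $\mathcal{S}$ of objects, an object $A$ is $\mathcal{S}$-filtered if $0\to A$ is a transfinite composition of inflations with cokernel in $\mathcal{S}$; the class of these objects is $\mathrm{Filt}\text{-}\mathcal{S}$. Assume that: - $I$ is homological: whenever $A\to 0$ has the right lifting property with respect to all morphisms in $I$, then $A\in(\mathrm{Cok}\,I)^{\perp_1}$; - $I$ admits the small object argument: the transfinite compositions of pushouts of morphisms in $I$ exist; the coproducts of set-indexed families of morphisms in $I$ exist (that is, those of their domains and of their codomains); and for the domain $D$ of each morphism in $I$ there is a cardinal $\kappa$ such that $\operatorname{Hom}(D,-)$ commutes with the colimit of every $\lambda$-sequence of morphisms in $I$-cell with $\mathrm{cf}(\lambda)>\kappa$; - every relative $I$-cell complex is an inflation. A class $\mathcal{T}$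 of objects is a class of generators if every object $A$ admits a deflation $\coprod_{s\in S}G_s\twoheadrightarrow A$ with $S$ a set and all $G_s\in\mathcal{T}$. A cotorsion pair is a pair $(\mathcal{X},\mathcal{Y})$ of classes of objects with $\mathcal{X}={}^{\perp_1}\mathcal{Y}$ and $\mathcal{Y}=\mathcal{X}^{\perp_1}$; it is complete if for every object $A$ there are short exact sequences $Y\rightarrowtail X\twoheadrightarrow A$ and $A\rightarrowtail Y'\twoheadrightarrow X'$ with $X,X'\in\mathcal{X}$ and $Y,Y'\in\mathcal{Y}$. A class of objects is closed under coproducts if it contains every set-indexed coproduct existing in $\mathcal{A}$ of objects of the class. Then: (a) For each object $A$ there is a short exact sequence $A\rightarrowtail T\twoheadrightarrow B$ with $T\in(\mathrm{Cok}\,I)^{\perp_1}$ and $B\in\mathrm{Cell}(I)$. In particular, $(\mathrm{Cok}\,I)^{\perp_1}$ is covariantly finite: each object $A$ has a morphism $A\to Y$ with $Y\in(\mathrm{Cok}\,I)^{\perp_1}$ through which every morphism from $A$ to an object of $(\mathrm{Cok}\,I)^{\perp_1}$ factors. (b) If $\mathrm{Cell}(I)$ is a class of generators, then $({}^{\perp_1}((\mathrm{Cok}\,I)^{\perp_1}),(\mathrm{Cok}\,I)^{\perp_1})$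 is a complete cotorsion pair. (c) If ${}^{\perp_1}((\mathrm{Cok}\,I)^{\perp_1})$ is closed under coproducts and is a class of generators, then for each object $A$ there is a short exact sequence $T'\rightarrowtail B'\twoheadrightarrow A$ with $T'\in(\mathrm{Cok}\,I)^{\perp_1}$ and $B'\in{}^{\perp_1}((\mathrm{Cok}\,I)^{\perp_1})$. In particular, $({}^{\perp_1}((\mathrm{Cok}\,I)^{\perp_1}),(\mathrm{Cok}\,I)^{\perp_1})$ is a complete cotorsion pair. (d) If $\mathrm{Filt}\text{-}\mathrm{Cok}\,I$ is closed under coproducts and extensions and is a class of generators, then ${}^{\perp_1}((\mathrm{Cok}\,I)^{\perp_1})$ consists precisely of the direct summands of $\mathrm{Cok}\,I$-filtered objects. -/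

import Mathlib

open CategoryTheory CategoryTheory.Limits
open scoped ZeroObject

universe v u

section GeneralCategories

variable {C : Type u} [Category.{v} C]

/-- For a nonzero ordinal `λ`, given as a well-ordered type `J`, a functor `F : J ⥤ C` is a
`λ`-sequence of morphisms in `D` if it is continuous at limit ordinals and every morphism
`F_α ⟶ F_{α+1}` with `α + 1 < λ` belongs to `D`. -/
structure IsSequenceOfMorphisms (D : MorphismProperty C) {J : Type v} [LinearOrder J]
    [OrderBot J] [SuccOrder J] [WellFoundedLT J] (F : J ⥤ C) : Prop where
  isWellOrderContinuous : F.IsWellOrderContinuous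
  map_mem (j : J) (hj : ¬ IsMax j) : D (F.map (homOfLE (Order.le_succ j)))

/-- The class `I-cell` of relative `I`-cell complexes: transfinite compositions of pushouts of
morphisms in `I`. -/
def relativeCellComplexes (I : MorphismProperty C) : MorphismProperty C :=
  MorphismProperty.transfiniteCompositions.{v} I.pushouts

/-- `A` is `κ`-small relative to `D`: for every ordinal `λ` of cofinality `> κ`, the functor
`Hom(A, -)` commutes with the colimits of all `λ`-sequences of morphisms in `D`. -/
def IsSmallRelativeWith (κ : Cardinal.{v}) (D : MorphismProperty C) (A : C) : Prop :=
  ∀ (J : Type v) [LinearOrder J] [OrderBot J] [SuccOrder J] [WellFoundedLT J] (F : J ⥤ C),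
    κ < Order.cof J → IsSequenceOfMorphisms D F →
      PreservesColimit F (coyoneda.obj (Opposite.op A))

/-- `A` is small relative to `D`. -/
def IsSmallRelative (D : MorphismProperty C) (A : C) : Prop :=
  ∃ κ : Cardinal.{v}, IsSmallRelativeWith κ D A

/-- `I` admits the small object argument. (Only used for sets `I` of inflations of an exact
category, for which the pushouts of morphisms in `I` always exist.) -/
structure AdmitsSmallObjectArgument (I : MorphismProperty C) : Prop where
  /-- the transfinite compositions of pushouts of morphisms in `I` exist -/
  hasTransfiniteCompositions (J : Type v) [LinearOrder J] [OrderBot J] [SuccOrder J]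
    [WellFoundedLT J] (F : J ⥤ C) : IsSequenceOfMorphisms I.pushouts F → HasColimit F
  /-- the coproducts of (set-indexed families of) morphisms in `I` exist -/
  hasCoproducts (S : Type v) (X Y : S → C) (f : ∀ s, X s ⟶ Y s) :
    (∀ s, I (f s)) → HasCoproduct X ∧ HasCoproduct Y
  /-- the domains of the morphisms in `I` are small relative to `I-cell` -/
  isSmallRelative {X Y : C} (f : X ⟶ Y) : I f → IsSmallRelative (relativeCellComplexes I) X

/-- A class of objects is closed under (set-indexed) coproducts: every coproduct in `C` of objects
of the class belongs to the class. -/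
def IsClosedUnderCoproducts (P : ObjectProperty C) : Prop :=
  ∀ (S : Type v) (G : S → C), (∀ s, P (G s)) →
    ∀ c : Cofan G, Nonempty (IsColimit c) → P c.pt

/-- `f : A ⟶ Y` is a left `P`-approximation of `A`. -/
def IsLeftApproximation (P : ObjectProperty C) {A Y : C} (f : A ⟶ Y) : Prop :=
  P Y ∧ ∀ (Y' : C), P Y' → ∀ g : A ⟶ Y', ∃ h : Y ⟶ Y', f ≫ h = g

/-- `P` is covariantly finite: every object has a left `P`-approximation. -/
def IsCovariantlyFinite (P : ObjectProperty C) : Prop :=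
  ∀ A : C, ∃ (Y : C) (f : A ⟶ Y), IsLeftApproximation P f

end GeneralCategories

section ExactCategories

/-- The morphisms that occur as the first morphism of a sequence in `K`. -/
def firstMorphisms {C : Type u} [Category.{v} C] [HasZeroMorphisms C]
    (K : ShortComplex C → Prop) : MorphismProperty C :=
  fun _ Y f => ∃ (Z : C) (g : Y ⟶ Z) (w : f ≫ g = 0), K (ShortComplex.mk f g w)

/-- The morphisms that occur as the second morphism of a sequence in `K`. -/
def secondMorphisms {C : Type u} [Category.{v} C] [HasZeroMorphisms C]
    (K : ShortComplex C → Prop) : MorphismProperty C :=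
  fun Y _ g => ∃ (X : C) (f : X ⟶ Y) (w : f ≫ g = 0), K (ShortComplex.mk f g w)

/-- A (Quillen) exact structure on an additive category. -/
structure ExactStructure (C : Type u) [Category.{v} C] [Preadditive C] [HasZeroObject C]
    [HasFiniteBiproducts C] where
  /-- the class of short exact sequences (conflations) -/
  conflation : ShortComplex C → Prop
  isKernel (S : ShortComplex C) : conflation S → Nonempty (IsLimit (KernelFork.ofι S.f S.zero))
  isCokernel (S : ShortComplex C) :
    conflation S → Nonempty (IsColimit (CokernelCofork.ofπ S.g S.zero))
  of_iso {S T : ShortComplex C} : Nonempty (S ≅ T) → conflation S → conflation T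
  id_inflation (A : C) : firstMorphisms conflation (𝟙 A)
  id_deflation (A : C) : secondMorphisms conflation (𝟙 A)
  comp_inflation {X Y Z : C} (f : X ⟶ Y) (g : Y ⟶ Z) : firstMorphisms conflation f →
    firstMorphisms conflation g → firstMorphisms conflation (f ≫ g)
  comp_deflation {X Y Z : C} (f : X ⟶ Y) (g : Y ⟶ Z) : secondMorphisms conflation f →
    secondMorphisms conflation g → secondMorphisms conflation (f ≫ g)
  pushout_inflation {X Y X' : C} (f : X ⟶ Y) (a : X ⟶ X') : firstMorphisms conflation f →
    ∃ (Y' : C) (b : Y ⟶ Y') (f' : X' ⟶ Y'), IsPushout f a b f' ∧ firstMorphisms conflation f'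
  pullback_deflation {Y Z Z' : C} (g : Y ⟶ Z) (c : Z' ⟶ Z) : secondMorphisms conflation g →
    ∃ (Y' : C) (b : Y' ⟶ Y) (g' : Y' ⟶ Z'), IsPullback b g' g c ∧ secondMorphisms conflation g'

namespace ExactStructure

variable {C : Type u} [Category.{v} C] [Preadditive C] [HasZeroObject C] [HasFiniteBiproducts C]
  (E : ExactStructure C)

/-- The inflations of the exact category. -/
def inflations : MorphismProperty C := firstMorphisms E.conflation

/-- The deflations of the exact category. -/
def deflations : MorphismProperty C := secondMorphisms E.conflation

/-- The short exact sequences `B ↣ mid ↠ A`. -/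
structure Extension (A B : C) where
  mid : C
  i : B ⟶ mid
  p : mid ⟶ A
  w : i ≫ p = 0
  conflation : E.conflation (ShortComplex.mk i p w)

/-- Two extensions of `A` by `B` are equivalent if there is an isomorphism between their middle
terms that is compatible with the identities of `A` and `B`. -/
instance extensionSetoid (A B : C) : Setoid (E.Extension A B) where
  r x y := ∃ e : x.mid ≅ y.mid, x.i ≫ e.hom = y.i ∧ e.hom ≫ y.p = x.p
  iseqv :=
    { refl := fun x => ⟨Iso.refl _, by simp, by simp⟩
      symm := by
        rintro x y ⟨e, h₁, h₂⟩
        exact ⟨e.symm, by simp [← h₁], by simp [← h₂]⟩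
      trans := by
        rintro x y z ⟨e, h₁, h₂⟩ ⟨e', h₃, h₄⟩
        exact ⟨e ≪≫ e', by simp [← h₃, ← h₁], by simp [← h₂, ← h₄]⟩ }

/-- The Yoneda `Ext¹(A, B)`: equivalence classes of short exact sequences `B ↣ mid ↠ A`. -/
def Ext1 (A B : C) : Type (max u v) := Quotient (E.extensionSetoid A B)

/-- `Ext¹(A, B) = 0`: there is only one class of extensions, that of the split ones, which is the
zero element for the Baer sum. -/
def Ext1Vanishes (A B : C) : Prop := Subsingleton (E.Ext1 A B)

/-- `P^⊥ = {Y | Ext¹(X, Y) = 0 for all X in P}`. -/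
def rightPerp (P : ObjectProperty C) : ObjectProperty C :=
  fun Y => ∀ X, P X → E.Ext1Vanishes X Y

/-- `^⊥P = {X | Ext¹(X, Y) = 0 for all Y in P}`. -/
def leftPerp (P : ObjectProperty C) : ObjectProperty C :=
  fun X => ∀ Y, P Y → E.Ext1Vanishes X Y

/-- `(𝒳, 𝒴)` is a cotorsion pair. -/
structure IsCotorsionPair (X Y : ObjectProperty C) : Prop where
  eq_leftPerp : X = E.leftPerp Y
  eq_rightPerp : Y = E.rightPerp X

/-- `(𝒳, 𝒴)` is a complete cotorsion pair. -/
structure IsCompleteCotorsionPair (X Y : ObjectProperty C) : Prop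
    extends E.IsCotorsionPair X Y where
  enough_projectives (A : C) : ∃ (K M : C) (f : K ⟶ M) (g : M ⟶ A) (w : f ≫ g = 0),
    E.conflation (ShortComplex.mk f g w) ∧ X M ∧ Y K
  enough_injectives (A : C) : ∃ (M Q : C) (f : A ⟶ M) (g : M ⟶ Q) (w : f ≫ g = 0),
    E.conflation (ShortComplex.mk f g w) ∧ X Q ∧ Y M

/-- `P` is a class of generators: every object `A` admits a deflation `∐ G_s ↠ A` from a
(set-indexed) coproduct of objects of `P`. -/
def IsClassOfGenerators (P : ObjectProperty C) : Prop :=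
  ∀ A : C, ∃ (S : Type v) (G : S → C) (c : Cofan G) (p : c.pt ⟶ A),
    (∀ s, P (G s)) ∧ Nonempty (IsColimit c) ∧ E.deflations p

/-- `P` is closed under extensions. -/
def IsClosedUnderExtensions (P : ObjectProperty C) : Prop :=
  ∀ S : ShortComplex C, E.conflation S → P S.X₁ → P S.X₃ → P S.X₂

/-- The inflations having a cokernel in `P`. -/
def inflationsWithCokernelIn (P : ObjectProperty C) : MorphismProperty C :=
  fun _ Y f => E.inflations f ∧ ∃ (Z : C) (g : Y ⟶ Z) (w : f ≫ g = 0),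
    Nonempty (IsColimit (CokernelCofork.ofπ g w)) ∧ P Z

/-- `Filt-P`, the `P`-filtered objects: those `A` for which `0 ⟶ A` is a transfinite composition of
inflations with cokernel in `P`. -/
def filtered (P : ObjectProperty C) : ObjectProperty C :=
  fun A => MorphismProperty.transfiniteCompositions.{v} (E.inflationsWithCokernelIn P)
    (0 : (0 : C) ⟶ A)

end ExactStructure

section Additive

variable {C : Type u} [Category.{v} C] [Preadditive C] [HasZeroObject C] [HasFiniteBiproducts C]

/-- `Cell(I)`, the `I`-cell complexes: those `A` for which `0 ⟶ A` is in `I-cell`. -/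
def cellComplexes (I : MorphismProperty C) : ObjectProperty C :=
  fun A => relativeCellComplexes I (0 : (0 : C) ⟶ A)

/-- `Cok I`, the objects that are a cokernel of some morphism in `I`. -/
def cokernelsOf (I : MorphismProperty C) : ObjectProperty C :=
  fun A => ∃ (X Y : C) (i : X ⟶ Y) (p : Y ⟶ A) (w : i ≫ p = 0),
    I i ∧ Nonempty (IsColimit (CokernelCofork.ofπ p w))

/-- `I` is homological: if `A ⟶ 0` has the right lifting property with respect to `I`, then
`A` belongs to `(Cok I)^⊥`. -/
def ExactStructure.IsHomological (E : ExactStructure C) (I : MorphismProperty C) : Prop :=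
  ∀ A : C, I.rlp (0 : A ⟶ (0 : C)) → E.rightPerp (cokernelsOf I) A

/-- `A` is a direct summand of an object of `P`: some biproduct `A ⊕ A'` belongs to `P`. -/
def IsDirectSummandOf (P : ObjectProperty C) : ObjectProperty C :=
  fun A => ∃ (A' : C) (b : BinaryBicone A A'), Nonempty b.IsBilimit ∧ P b.pt

end Additive

end ExactCategories

universe w v' u'

/-!
If `A ↣ T` is a relative `I`-cell complex such that `T ⟶ 0` has the right lifting property with
respect to `I`, then `T` lies in `(Cok I)^⊥` because `I` is homological, and the cokernel of
`A ↣ T` is a cell complex, being the pushout of `A ↣ T` along `A ⟶ 0`. Such a `T` is provided by the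
small object argument. Since the category is not cocomplete, the iteration runs in the opposite of
the category of functors to sets, where all colimits exist: each step attaches all cells at once,
and is resolved into attachments of single cells. The resulting sequence stays in the image of the
Yoneda embedding, because pushouts of `I` and transfinite compositions of these exist in the
original category.

As `Y` lies in `P^⊥` if and only if the inflations with cokernel in `P` lift against the deflations
with kernel `Y`, and left lifting classes are closed under transfinite composition, filtered objects
lie in `^⊥((Cok I)^⊥)`. If `K` is the kernel of a deflation `G ↠ A` from a coproduct of generators
and `K ↣ T ↠ B` is the sequence constructed above, then the pushout of `G` and `T` under `K` is an
extension of `A` by `T` and of `B` by `G`, which gives the remaining approximations.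
-/

namespace ExactStructure

attribute [local instance] hasBinaryBiproducts_of_finite_biproducts

variable {C : Type u} [Category.{v} C] [Preadditive C] [HasZeroObject C] [HasFiniteBiproducts C]
  {E : ExactStructure C}

/-- The pair `(f, g)` is a short exact sequence `X ↣ Y ↠ Z`. -/
def IsConflation (E : ExactStructure C) {X Y Z : C} (f : X ⟶ Y) (g : Y ⟶ Z) : Prop :=
  ∃ w : f ≫ g = 0, E.conflation (ShortComplex.mk f g w)

namespace IsConflation

variable {X Y Z : C} {f : X ⟶ Y} {g : Y ⟶ Z}

lemma zero (h : E.IsConflation f g) : f ≫ g = 0 := h.choose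

lemma inflation (h : E.IsConflation f g) : E.inflations f := ⟨_, _, _, h.choose_spec⟩

lemma deflation (h : E.IsConflation f g) : E.deflations g := ⟨_, _, _, h.choose_spec⟩

lemma exists_lift (h : E.IsConflation f g) {W : C} (k : W ⟶ Y) (hk : k ≫ g = 0) :
    ∃ l : W ⟶ X, l ≫ f = k := by
  obtain ⟨w, h⟩ := h
  obtain ⟨hl⟩ := E.isKernel _ h
  exact ⟨_, (KernelFork.IsLimit.lift' hl k hk).2⟩

lemma exists_desc (h : E.IsConflation f g) {W : C} (k : Y ⟶ W) (hk : f ≫ k = 0) :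
    ∃ l : Z ⟶ W, g ≫ l = k := by
  obtain ⟨w, h⟩ := h
  obtain ⟨hl⟩ := E.isCokernel _ h
  exact ⟨_, (CokernelCofork.IsColimit.desc' hl k hk).2⟩

lemma mono (h : E.IsConflation f g) : Mono f := by
  obtain ⟨w, h⟩ := h
  obtain ⟨hl⟩ := E.isKernel _ h
  exact mono_of_isLimit_fork hl

lemma epi (h : E.IsConflation f g) : Epi g := by
  obtain ⟨w, h⟩ := h
  obtain ⟨hl⟩ := E.isCokernel _ h
  exact epi_of_isColimit_cofork hl

lemma nonempty_isColimit (h : E.IsConflation f g) :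
    Nonempty (IsColimit (CokernelCofork.ofπ g h.zero)) :=
  E.isCokernel _ h.choose_spec

lemma of_iso {X' Y' Z' : C} {f' : X' ⟶ Y'} {g' : Y' ⟶ Z'} (h : E.IsConflation f g)
    (e₁ : X ≅ X') (e₂ : Y ≅ Y') (e₃ : Z ≅ Z') (hf : e₁.hom ≫ f' = f ≫ e₂.hom)
    (hg : e₂.hom ≫ g' = g ≫ e₃.hom) : E.IsConflation f' g' := by
  obtain ⟨w, h⟩ := h
  have w' : f' ≫ g' = 0 := by
    rw [← cancel_epi e₁.hom, ← Category.assoc, hf, Category.assoc, hg, ← Category.assoc, w]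
    simp
  exact ⟨w', E.of_iso ⟨ShortComplex.isoMk e₁ e₂ e₃ hf hg⟩ h⟩

end IsConflation

lemma exists_isConflation_of_inflation {X Y : C} {f : X ⟶ Y} (hf : E.inflations f) :
    ∃ (Z : C) (g : Y ⟶ Z), E.IsConflation f g := by
  obtain ⟨Z, g, w, h⟩ := hf
  exact ⟨Z, g, w, h⟩

lemma exists_isConflation_of_deflation {Y Z : C} {g : Y ⟶ Z} (hg : E.deflations g) :
    ∃ (X : C) (f : X ⟶ Y), E.IsConflation f g := by
  obtain ⟨X, f, w, h⟩ := hg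
  exact ⟨X, f, w, h⟩

lemma isConflation_of_deflation {X Y Z : C} {f : X ⟶ Y} {g : Y ⟶ Z} (hg : E.deflations g)
    (w : f ≫ g = 0) [Mono f]
    (hf : ∀ {W : C} (k : W ⟶ Y), k ≫ g = 0 → ∃ l : W ⟶ X, l ≫ f = k) :
    E.IsConflation f g := by
  obtain ⟨X₀, f₀, h⟩ := exists_isConflation_of_deflation hg
  have := h.mono
  obtain ⟨l, hl⟩ := hf f₀ h.zero
  obtain ⟨l', hl'⟩ := h.exists_lift f w
  refine h.of_iso ⟨l, l', ?_, ?_⟩ (Iso.refl _) (Iso.refl _) (by simpa) (by simp)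
  · rw [← cancel_mono f₀]; simp [hl, hl']
  · rw [← cancel_mono f]; simp [hl, hl']

lemma isConflation_of_inflation {X Y Z : C} {f : X ⟶ Y} {g : Y ⟶ Z} (hf : E.inflations f)
    (w : f ≫ g = 0) [Epi g]
    (hg : ∀ {W : C} (k : Y ⟶ W), f ≫ k = 0 → ∃ l : Z ⟶ W, g ≫ l = k) :
    E.IsConflation f g := by
  obtain ⟨Z₀, g₀, h⟩ := exists_isConflation_of_inflation hf
  have := h.epi
  obtain ⟨l, hl⟩ := hg g₀ h.zero
  obtain ⟨l', hl'⟩ := h.exists_desc g w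
  refine h.of_iso (Iso.refl _) (Iso.refl _) ⟨l', l, ?_, ?_⟩ (by simp) (by simpa using hl'.symm)
  · rw [← cancel_epi g₀]; simp [reassoc_of% hl', hl]
  · rw [← cancel_epi g]; simp [reassoc_of% hl, hl']

lemma isConflation_of_isColimit {X Y Z : C} {f : X ⟶ Y} {g : Y ⟶ Z} (hf : E.inflations f)
    (w : f ≫ g = 0) (hg : IsColimit (CokernelCofork.ofπ g w)) : E.IsConflation f g := by
  have : Epi g := epi_of_isColimit_cofork hg
  exact isConflation_of_inflation hf w
    (fun k hk ↦ ⟨_, (CokernelCofork.IsColimit.desc' hg k hk).2⟩)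

lemma inflations_of_iso {X Y X' Y' : C} {f : X ⟶ Y} {f' : X' ⟶ Y'} (hf : E.inflations f)
    (e₁ : X ≅ X') (e₂ : Y ≅ Y') (h : e₁.hom ≫ f' = f ≫ e₂.hom) : E.inflations f' := by
  obtain ⟨Z, g, hg⟩ := exists_isConflation_of_inflation hf
  exact (hg.of_iso e₁ e₂ (Iso.refl _) h (g' := e₂.inv ≫ g) (by simp)).inflation

lemma deflations_of_iso {X Y X' Y' : C} {f : X ⟶ Y} {f' : X' ⟶ Y'} (hf : E.deflations f)
    (e₁ : X ≅ X') (e₂ : Y ≅ Y') (h : e₁.hom ≫ f' = f ≫ e₂.hom) : E.deflations f' := by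
  obtain ⟨Z, g, hg⟩ := exists_isConflation_of_deflation hf
  exact (hg.of_iso (Iso.refl _) e₁ e₂ (f' := g ≫ e₁.hom) (by simp) h).deflation

variable (E) in
lemma isConflation_zero_id (X : C) : E.IsConflation (0 : (0 : C) ⟶ X) (𝟙 X) :=
  isConflation_of_deflation (E.id_deflation X) (by simp)
    (fun k hk ↦ ⟨0, by simpa using hk.symm⟩)

lemma IsConflation.of_isPushout {X Y Z X' Y' : C} {f : X ⟶ Y} {g : Y ⟶ Z} {a : X ⟶ X'}
    {b : Y ⟶ Y'} {f' : X' ⟶ Y'} (h : E.IsConflation f g) (sq : IsPushout f a b f') :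
    ∃ g' : Y' ⟶ Z, b ≫ g' = g ∧ E.IsConflation f' g' := by
  obtain ⟨Y₀, b₀, f₀, sq₀, hf₀⟩ := E.pushout_inflation f a h.inflation
  have hf' : E.inflations f' := inflations_of_iso (E := E) hf₀ (Iso.refl _)
    (sq₀.isoIsPushout _ _ sq) (by simp)
  obtain ⟨g', hg₁, hg₂⟩ : ∃ g', b ≫ g' = g ∧ f' ≫ g' = 0 :=
    ⟨sq.desc g 0 (by simp [h.zero]), by simp, by simp⟩
  have := h.epi
  have : Epi g' := epi_of_epi_fac hg₁
  refine ⟨g', hg₁, isConflation_of_inflation hf' hg₂ (fun k hk ↦ ?_)⟩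
  obtain ⟨l, hl⟩ := h.exists_desc (b ≫ k) (by rw [sq.w_assoc, hk, comp_zero])
  exact ⟨l, sq.hom_ext (by rw [← hl, reassoc_of% hg₁]) (by rw [reassoc_of% hg₂, hk, zero_comp])⟩

lemma IsConflation.of_isPullback {X Y Z Y' Z' : C} {f : X ⟶ Y} {g : Y ⟶ Z} {c : Z' ⟶ Z}
    {b : Y' ⟶ Y} {g' : Y' ⟶ Z'} (h : E.IsConflation f g) (sq : IsPullback b g' g c) :
    ∃ f' : X ⟶ Y', f' ≫ b = f ∧ E.IsConflation f' g' := by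
  obtain ⟨Y₀, b₀, g₀, sq₀, hg₀⟩ := E.pullback_deflation g c h.deflation
  have hg' : E.deflations g' := deflations_of_iso (E := E) hg₀
    (sq₀.isoIsPullback _ _ sq) (Iso.refl _) (by simp)
  obtain ⟨f', hf₁, hf₂⟩ : ∃ f', f' ≫ b = f ∧ f' ≫ g' = 0 :=
    ⟨sq.lift f 0 (by simp [h.zero]), by simp, by simp⟩
  have := h.mono
  have : Mono f' := mono_of_mono_fac hf₁
  refine ⟨f', hf₁, isConflation_of_deflation hg' hf₂ (fun k hk ↦ ?_)⟩
  obtain ⟨l, hl⟩ := h.exists_lift (k ≫ b) (by rw [Category.assoc, sq.w, reassoc_of% hk, zero_comp])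
  exact ⟨l, sq.hom_ext (by rw [← hl, Category.assoc, hf₁])
    (by rw [Category.assoc, hf₂, hk, comp_zero])⟩

lemma exists_isPushout {X Y X' : C} {f : X ⟶ Y} (hf : E.inflations f) (a : X ⟶ X') :
    ∃ (Y' : C) (b : Y ⟶ Y') (f' : X' ⟶ Y'), IsPushout f a b f' := by
  obtain ⟨Y', b, f', h, _⟩ := E.pushout_inflation f a hf
  exact ⟨Y', b, f', h⟩

lemma exists_isPullback {Y Z Z' : C} {g : Y ⟶ Z} (hg : E.deflations g) (c : Z' ⟶ Z) :
    ∃ (Y' : C) (b : Y' ⟶ Y) (g' : Y' ⟶ Z'), IsPullback b g' g c := by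
  obtain ⟨Y', b, f', h, _⟩ := E.pullback_deflation g c hg
  exact ⟨Y', b, f', h⟩

variable (E) in
lemma isConflation_inl_snd (X Y : C) :
    E.IsConflation (biprod.inl : X ⟶ X ⊞ Y) (biprod.snd : X ⊞ Y ⟶ Y) := by
  obtain ⟨g, hg, h⟩ := (isConflation_zero_id E Y).of_isPushout
    (IsPushout.of_has_biproduct X Y).flip
  obtain rfl : g = biprod.snd := biprod.hom_ext' _ _ (by simp [h.zero]) (by simp [hg])
  exact h

lemma IsConflation.exists_iso_of_section {X Y Z : C} {f : X ⟶ Y} {g : Y ⟶ Z}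
    (h : E.IsConflation f g) (s : Z ⟶ Y) (hs : s ≫ g = 𝟙 Z) :
    ∃ e : X ⊞ Z ≅ Y, biprod.inl ≫ e.hom = f ∧ biprod.inr ≫ e.hom = s ∧
      e.hom ≫ g = biprod.snd := by
  have := h.mono
  obtain ⟨r, hr⟩ := h.exists_lift (𝟙 Y - g ≫ s) (by simp [Preadditive.sub_comp, hs])
  have hfr : f ≫ r = 𝟙 X := by
    rw [← cancel_mono f, Category.assoc, hr]
    simp [Preadditive.comp_sub, reassoc_of% h.zero]
  have hsr : s ≫ r = 0 := by
    rw [← cancel_mono f, Category.assoc, hr]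
    simp [Preadditive.comp_sub, reassoc_of% hs]
  refine ⟨⟨biprod.desc f s, biprod.lift r g, ?_, ?_⟩, by simp, by simp, ?_⟩
  · apply biprod.hom_ext' <;> apply biprod.hom_ext <;> simp [hfr, hsr, h.zero, hs]
  · simp [biprod.lift_desc, hr]
  · apply biprod.hom_ext' <;> simp [h.zero, hs]

lemma ext1Vanishes_iff_exists_section {A B : C} :
    E.Ext1Vanishes A B ↔ ∀ {M : C} (i : B ⟶ M) (p : M ⟶ A), E.IsConflation i p →
      ∃ s : A ⟶ M, s ≫ p = 𝟙 A := by
  constructor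
  · intro h M i p hip
    obtain ⟨e, _, he⟩ := Quotient.exact (s := E.extensionSetoid A B)
      (@Subsingleton.elim _ h
        (Quotient.mk _ ⟨B ⊞ A, biprod.inl, biprod.snd, _,
          (isConflation_inl_snd E B A).choose_spec⟩)
        (Quotient.mk _ ⟨M, i, p, _, hip.choose_spec⟩))
    exact ⟨biprod.inr ≫ e.hom, by simp [he]⟩
  · intro h
    refine ⟨fun x y ↦ ?_⟩
    induction x using Quotient.inductionOn with | _ x
    induction y using Quotient.inductionOn with | _ y
    obtain ⟨s, hs⟩ := h x.i x.p ⟨x.w, x.conflation⟩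
    obtain ⟨t, ht⟩ := h y.i y.p ⟨y.w, y.conflation⟩
    obtain ⟨e, he₁, _, he₃⟩ :=
      IsConflation.exists_iso_of_section (E := E) ⟨x.w, x.conflation⟩ s hs
    obtain ⟨e', he₁', _, he₃'⟩ :=
      IsConflation.exists_iso_of_section (E := E) ⟨y.w, y.conflation⟩ t ht
    exact Quotient.sound ⟨e.symm ≪≫ e', by simp [← he₁, he₁'], by simp [← he₃, he₃']⟩

lemma Ext1Vanishes.exists_section {A B M : C} (h : E.Ext1Vanishes A B) {i : B ⟶ M} {p : M ⟶ A}
    (hip : E.IsConflation i p) : ∃ s : A ⟶ M, s ≫ p = 𝟙 A :=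
  ext1Vanishes_iff_exists_section.1 h i p hip

lemma Ext1Vanishes.exists_retraction {A B M : C} (h : E.Ext1Vanishes A B) {i : B ⟶ M} {p : M ⟶ A}
    (hip : E.IsConflation i p) : ∃ r : M ⟶ B, i ≫ r = 𝟙 B := by
  obtain ⟨s, hs⟩ := h.exists_section hip
  obtain ⟨e, he, _⟩ := hip.exists_iso_of_section s hs
  exact ⟨e.inv ≫ biprod.fst, by simp [← he]⟩

lemma Ext1Vanishes.exists_extension {N M S Y : C} (h : E.Ext1Vanishes S Y) {k : N ⟶ M}
    {q : M ⟶ S} (hk : E.IsConflation k q) (t : N ⟶ Y) : ∃ e : M ⟶ Y, k ≫ e = t := by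
  obtain ⟨P, b, j, sq⟩ := exists_isPushout hk.inflation t
  obtain ⟨q', -, hq'⟩ := hk.of_isPushout sq
  obtain ⟨r, hr⟩ := h.exists_retraction hq'
  exact ⟨b ≫ r, by rw [sq.w_assoc, hr, Category.comp_id]⟩

lemma Ext1Vanishes.exists_section_extension {X X' S Y M : C} (hSY : E.Ext1Vanishes S Y)
    {f : X ⟶ X'} {g : X' ⟶ S} (hf : E.IsConflation f g) {i : Y ⟶ M} {p : M ⟶ X'}
    (hp : E.IsConflation i p) (u : X ⟶ M) (hu : u ≫ p = f) :
    ∃ s : X' ⟶ M, s ≫ p = 𝟙 X' ∧ f ≫ s = u := by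
  have := hf.mono
  have := hp.epi
  -- On `N = p⁻¹(X)`, the map `k - q ≫ u` takes values in `Y`. Extend it to `e : M ⟶ Y`; then
  -- `𝟙 M - e ≫ i` kills `Y`, and on `N` it is `q ≫ u`, so it factors through a section of `p`.
  obtain ⟨N, k, hk⟩ := exists_isConflation_of_deflation (E := E)
    (E.comp_deflation p g hp.deflation hf.deflation)
  obtain ⟨q, hq⟩ := hf.exists_lift (k ≫ p) (by simp [hk.zero])
  obtain ⟨t, ht⟩ := hp.exists_lift (k - q ≫ u) (by simp [hu, hq])
  obtain ⟨e, he⟩ := hSY.exists_extension hk t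
  have hke : k ≫ (𝟙 M - e ≫ i) = q ≫ u := by
    simp [Preadditive.comp_sub, reassoc_of% he, ht]
  have hlift {W : C} (l : W ⟶ M) (a : W ⟶ X) (hl : l ≫ p = a ≫ f) :
      l ≫ (𝟙 M - e ≫ i) = a ≫ u := by
    obtain ⟨l', rfl⟩ := hk.exists_lift l (by simp [reassoc_of% hl, hf.zero])
    have hlq : l' ≫ q = a := by rw [← cancel_mono f, Category.assoc, hq, ← hl, Category.assoc]
    rw [Category.assoc, hke, reassoc_of% hlq]
  obtain ⟨s, hs⟩ := hp.exists_desc (𝟙 M - e ≫ i) (by simpa using hlift i 0 (by simp [hp.zero]))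
  refine ⟨s, ?_, ?_⟩
  · rw [← cancel_epi p, reassoc_of% hs]
    simp [Preadditive.sub_comp, hp.zero]
  · rw [← hu, Category.assoc, hs, hlift u (𝟙 X) (by simp [hu]), Category.id_comp]

/-- The deflations whose kernel belongs to `P`; the lifting property against them detects `^⊥P`. -/
def deflationsWithKernelIn (E : ExactStructure C) (P : ObjectProperty C) : MorphismProperty C :=
  fun M _ p ↦ ∃ (Y : C) (i : Y ⟶ M), E.IsConflation i p ∧ P Y

lemma hasLiftingProperty_of_ext1Vanishes {X X' S Y M Z : C} (hSY : E.Ext1Vanishes S Y)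
    {f : X ⟶ X'} {g : X' ⟶ S} (hf : E.IsConflation f g) {i : Y ⟶ M} {p : M ⟶ Z}
    (hp : E.IsConflation i p) : HasLiftingProperty f p where
  sq_hasLift {a b} sq := by
    obtain ⟨M', c, p', sq'⟩ := exists_isPullback hp.deflation b
    obtain ⟨i', -, hp'⟩ := hp.of_isPullback sq'
    obtain ⟨s, hs₁, hs₂⟩ := hSY.exists_section_extension hf hp' (sq'.lift a f sq.w) (by simp)
    exact ⟨⟨s ≫ c, by rw [reassoc_of% hs₂]; simp, by rw [Category.assoc, sq'.w, reassoc_of% hs₁]⟩⟩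

lemma llp_of_leftPerp {P : ObjectProperty C} {X Y Z : C} {f : X ⟶ Y} {g : Y ⟶ Z}
    (h : E.IsConflation f g) (hZ : E.leftPerp P Z) : (E.deflationsWithKernelIn P).llp f := by
  rintro M W p ⟨K, i, hp, hK⟩
  exact hasLiftingProperty_of_ext1Vanishes (hZ K hK) h hp

lemma exists_lift_of_llp {P : ObjectProperty C} {X M Z : C}
    (hX : (E.deflationsWithKernelIn P).llp (0 : (0 : C) ⟶ X)) {p : M ⟶ Z}
    (hp : E.deflationsWithKernelIn P p) (a : X ⟶ Z) : ∃ l : X ⟶ M, l ≫ p = a := by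
  have := hX p hp
  have sq : CommSq (0 : (0 : C) ⟶ M) (0 : (0 : C) ⟶ X) p a := ⟨by simp⟩
  exact ⟨sq.lift, sq.fac_right⟩

lemma leftPerp_iff_llp {P : ObjectProperty C} {X : C} :
    E.leftPerp P X ↔ (E.deflationsWithKernelIn P).llp (0 : (0 : C) ⟶ X) :=
  ⟨llp_of_leftPerp (isConflation_zero_id E X), fun h Y hY ↦
    ext1Vanishes_iff_exists_section.2 fun i _ hp ↦ exists_lift_of_llp h ⟨Y, i, hp, hY⟩ (𝟙 X)⟩

lemma isClosedUnderExtensions_leftPerp (P : ObjectProperty C) :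
    E.IsClosedUnderExtensions (E.leftPerp P) := by
  intro S hS h₁ h₃
  rw [leftPerp_iff_llp] at h₁ ⊢
  simpa using MorphismProperty.comp_mem _ _ _ h₁ (llp_of_leftPerp ⟨S.zero, hS⟩ h₃)

lemma leftPerp_of_retract {P : ObjectProperty C} {X Y : C} (r : Retract X Y)
    (hY : E.leftPerp P Y) : E.leftPerp P X := by
  rw [leftPerp_iff_llp] at hY ⊢
  have : RetractArrow (0 : (0 : C) ⟶ X) (0 : (0 : C) ⟶ Y) :=
    { i := Arrow.homMk 0 r.i (by simp)
      r := Arrow.homMk 0 r.r (by simp)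
      retract := by ext <;> simp }
  exact MorphismProperty.of_retract this hY

lemma isClosedUnderCoproducts_leftPerp (P : ObjectProperty C) :
    IsClosedUnderCoproducts (E.leftPerp P) := by
  intro S G hG c ⟨hc⟩ Y hY
  rw [ext1Vanishes_iff_exists_section]
  intro M i p hp
  choose t ht using fun s ↦ exists_lift_of_llp (leftPerp_iff_llp.1 (hG s)) ⟨Y, i, hp, hY⟩ (c.inj s)
  exact ⟨Cofan.IsColimit.desc hc t, Cofan.IsColimit.hom_ext hc _ _ (by simp [ht])⟩

lemma le_leftPerp_rightPerp (P : ObjectProperty C) : P ≤ E.leftPerp (E.rightPerp P) :=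
  fun X hX _ hY ↦ hY X hX

lemma isCotorsionPair_leftPerp_rightPerp (P : ObjectProperty C) :
    E.IsCotorsionPair (E.leftPerp (E.rightPerp P)) (E.rightPerp P) where
  eq_leftPerp := rfl
  eq_rightPerp := le_antisymm (fun Y hY _ hX ↦ hX Y hY)
    (fun _ hY X hX ↦ hY X (le_leftPerp_rightPerp P X hX))

lemma inflationsWithCokernelIn_le_llp (P : ObjectProperty C) :
    E.inflationsWithCokernelIn P ≤ (E.deflationsWithKernelIn (E.rightPerp P)).llp := by
  rintro X Y f ⟨hf, Z, g, w, ⟨hg⟩, hZ⟩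
  exact llp_of_leftPerp (isConflation_of_isColimit hf w hg) (le_leftPerp_rightPerp P Z hZ)

/-- The Eklof lemma. -/
lemma filtered_le_leftPerp_rightPerp (P : ObjectProperty C) :
    E.filtered P ≤ E.leftPerp (E.rightPerp P) := fun _ hX ↦
  leftPerp_iff_llp.2
    (MorphismProperty.transfiniteCompositions_le_iff.2 (inflationsWithCokernelIn_le_llp P) _ hX)

lemma pushouts_le_inflationsWithCokernelIn {I : MorphismProperty C} (hI : I ≤ E.inflations) :
    I.pushouts ≤ E.inflationsWithCokernelIn (cokernelsOf I) := by
  rintro X' Y' f' ⟨X, Y, f, a, b, hf, sq⟩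
  obtain ⟨Z, g, h⟩ := exists_isConflation_of_inflation (hI _ hf)
  obtain ⟨g', -, h'⟩ := h.of_isPushout sq.flip
  exact ⟨h'.inflation, Z, g', h'.zero, h'.nonempty_isColimit,
    X, Y, f, g, h.zero, hf, h.nonempty_isColimit⟩

lemma cellComplexes_le_filtered {I : MorphismProperty C} (hI : I ≤ E.inflations) :
    cellComplexes I ≤ E.filtered (cokernelsOf I) :=
  fun _ hX ↦ MorphismProperty.transfiniteCompositions_monotone
    (pushouts_le_inflationsWithCokernelIn hI) _ hX

lemma IsClassOfGenerators.mono {P Q : ObjectProperty C} (hP : E.IsClassOfGenerators P)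
    (h : P ≤ Q) : E.IsClassOfGenerators Q := by
  intro A
  obtain ⟨S, G, c, p, hG, hc, hp⟩ := hP A
  exact ⟨S, G, c, p, fun s ↦ h _ (hG s), hc, hp⟩

/-- Every object `A` has a special `P`-preenvelope with cokernel in `Q`, that is, a short exact
sequence `A ↣ T ↠ B` with `T` in `P` and `B` in `Q`. -/
def HasSpecialPreenvelopes (E : ExactStructure C) (P Q : ObjectProperty C) : Prop :=
  ∀ A : C, ∃ (T B : C) (f : A ⟶ T) (g : T ⟶ B) (w : f ≫ g = 0),
    E.conflation (ShortComplex.mk f g w) ∧ P T ∧ Q B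

/-- Every object `A` has a special `Q`-precover with kernel in `P`, that is, a short exact sequence
`T ↣ B ↠ A` with `T` in `P` and `B` in `Q`. -/
def HasSpecialPrecovers (E : ExactStructure C) (P Q : ObjectProperty C) : Prop :=
  ∀ A : C, ∃ (T B : C) (f : T ⟶ B) (g : B ⟶ A) (w : f ≫ g = 0),
    E.conflation (ShortComplex.mk f g w) ∧ P T ∧ Q B

namespace HasSpecialPreenvelopes

variable {P Q Q' : ObjectProperty C}

lemma mono (h : E.HasSpecialPreenvelopes P Q) (hQ : Q ≤ Q') : E.HasSpecialPreenvelopes P Q' := by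
  intro A
  obtain ⟨T, B, f, g, w, hfg, hT, hB⟩ := h A
  exact ⟨T, B, f, g, w, hfg, hT, hQ _ hB⟩

lemma isCovariantlyFinite (h : E.HasSpecialPreenvelopes P (E.leftPerp P)) :
    IsCovariantlyFinite P := by
  intro A
  obtain ⟨T, B, f, g, w, hfg, hT, hB⟩ := h A
  exact ⟨T, f, hT, fun Y hY a ↦ (hB Y hY).exists_extension ⟨w, hfg⟩ a⟩

/-- Salce's trick: push out a short exact sequence `K ↣ G ↠ A` along a special preenvelope
`K ↣ T` of its kernel. -/
lemma hasSpecialPrecovers (h : E.HasSpecialPreenvelopes P Q) (hcoprod : IsClosedUnderCoproducts Q)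
    (hext : E.IsClosedUnderExtensions Q) (hgen : E.IsClassOfGenerators Q) :
    E.HasSpecialPrecovers P Q := by
  intro A
  obtain ⟨S, G, c, p, hG, hc, hp⟩ := hgen A
  obtain ⟨K, k, hk⟩ := exists_isConflation_of_deflation hp
  obtain ⟨T, B, f, g, w, hfg, hT, hB⟩ := h K
  obtain ⟨M, b, f', sq⟩ := exists_isPushout hk.inflation f
  obtain ⟨p', -, w', hp'⟩ := hk.of_isPushout sq
  obtain ⟨g', -, _, hg'⟩ := IsConflation.of_isPushout ⟨w, hfg⟩ sq.flip
  exact ⟨T, M, f', p', w', hp', hT, hext _ hg' (hcoprod S G hG c hc) hB⟩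

lemma isCompleteCotorsionPair
    (h : E.HasSpecialPreenvelopes (E.rightPerp P) (E.leftPerp (E.rightPerp P)))
    (h' : E.HasSpecialPrecovers (E.rightPerp P) (E.leftPerp (E.rightPerp P))) :
    E.IsCompleteCotorsionPair (E.leftPerp (E.rightPerp P)) (E.rightPerp P) where
  __ := isCotorsionPair_leftPerp_rightPerp P
  enough_projectives A := by
    obtain ⟨T, B, f, g, w, hfg, hT, hB⟩ := h' A
    exact ⟨T, B, f, g, w, hfg, hB, hT⟩
  enough_injectives A := by
    obtain ⟨T, B, f, g, w, hfg, hT, hB⟩ := h A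
    exact ⟨T, B, f, g, w, hfg, hB, hT⟩

end HasSpecialPreenvelopes

lemma IsConflation.isDirectSummandOf {P : ObjectProperty C} {T M A : C} {f : T ⟶ M}
    {g : M ⟶ A} (h : E.IsConflation f g) (hTA : E.Ext1Vanishes A T) (hM : P M) :
    IsDirectSummandOf P A := by
  obtain ⟨s, hs⟩ := hTA.exists_section h
  obtain ⟨e, -, he, he'⟩ := h.exists_iso_of_section s hs
  let b : BinaryBicone A T :=
    { pt := M
      fst := g
      snd := e.inv ≫ biprod.fst
      inl := s
      inr := biprod.inl ≫ e.hom
      inl_fst := hs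
      inl_snd := by simp [← he]
      inr_fst := by simp [he']
      inr_snd := by simp }
  have hg : g = e.inv ≫ biprod.snd := by simp [← he']
  refine ⟨T, b, ⟨isBinaryBilimitOfTotal b ?_⟩, hM⟩
  dsimp [b]
  rw [← cancel_epi e.hom, ← cancel_mono e.inv, hg, ← he]
  apply biprod.hom_ext' <;> apply biprod.hom_ext <;> simp

lemma leftPerp_iff_isDirectSummandOf {P Q : ObjectProperty C} (h : E.HasSpecialPrecovers P Q)
    (hQ : Q ≤ E.leftPerp P) (A : C) : E.leftPerp P A ↔ IsDirectSummandOf Q A := by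
  constructor
  · intro hA
    obtain ⟨T, M, f, g, w, hfg, hT, hM⟩ := h A
    exact IsConflation.isDirectSummandOf ⟨w, hfg⟩ (hA T hT) hM
  · rintro ⟨A', b, -, hb⟩
    exact leftPerp_of_retract ⟨b.inl, b.fst, b.inl_fst⟩ (hQ _ hb)

end ExactStructure

section CobaseChange

variable {C : Type u} [Category.{v} C]

lemma nonempty_isColimit_of_isPushout {K : Type*} [Category* K] {F P : K ⥤ C} (π : F ⟶ P)
    {b : K} (i : ∀ j, b ⟶ j)
    (hπ : ∀ j, IsPushout (F.map (i j)) (π.app b) (π.app j) (P.map (i j)))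
    {c : Cocone F} (hc : IsColimit c) {d : Cocone P} {θ : c.pt ⟶ d.pt}
    (hθ : ∀ j, π.app j ≫ d.ι.app j = c.ι.app j ≫ θ)
    (sq : IsPushout (c.ι.app b) (π.app b) θ (d.ι.app b)) : Nonempty (IsColimit d) := by
  have hfac (s : Cocone P) : c.ι.app b ≫ hc.desc ((Cocone.precompose π).obj s) =
      π.app b ≫ s.ι.app b := hc.fac _ b
  refine ⟨{ desc s := sq.desc _ _ (hfac s), fac s j := (hπ j).hom_ext ?_ ?_, uniq s m hm := ?_ }⟩
  · rw [reassoc_of% hθ j, sq.inl_desc, hc.fac]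
    rfl
  · rw [← Category.assoc, d.w, sq.inr_desc, s.w]
  · refine sq.hom_ext (hc.hom_ext fun j ↦ ?_) (by rw [sq.inr_desc, hm])
    rw [sq.inl_desc, hc.fac, ← reassoc_of% hθ j, hm]
    rfl

section

variable {J : Type*} [LinearOrder J] [OrderBot J] {F : J ⥤ C}

lemma exists_isPushout_functor {X' : C} {a : F.obj ⊥ ⟶ X'}
    (h : ∀ j, ∃ (P : C) (π : F.obj j ⟶ P) (ρ : X' ⟶ P),
      IsPushout (F.map (homOfLE (bot_le : ⊥ ≤ j))) a π ρ) :
    ∃ (P : J ⥤ C) (π : F ⟶ P) (e : X' ≅ P.obj ⊥), π.app ⊥ = a ≫ e.hom ∧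
      ∀ j, IsPushout (F.map (homOfLE bot_le)) (π.app ⊥) (π.app j) (P.map (homOfLE bot_le)) := by
  choose P π ρ sq using h
  let G : J ⥤ C :=
    { obj := P
      map {j k} φ := (sq j).desc (F.map φ ≫ π k) (ρ k) (by
        rw [← F.map_comp_assoc, Subsingleton.elim (homOfLE _ ≫ φ) (homOfLE bot_le), (sq k).w])
      map_id j := (sq j).hom_ext (by simp) (by simp)
      map_comp {j k l} φ ψ := (sq j).hom_ext (by simp) (by simp) }
  have : IsIso (ρ ⊥) := (MorphismProperty.isomorphisms C).of_isPushout (sq ⊥).flip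
    (by simpa using inferInstanceAs (IsIso (𝟙 _)))
  have hπ : π ⊥ = a ≫ ρ ⊥ := by simpa using (sq ⊥).w
  refine ⟨G, { app := π, naturality j k φ := ((sq j).inl_desc _ _ _).symm }, asIso (ρ ⊥), hπ,
    fun j ↦ ?_⟩
  exact (sq j).of_iso (Iso.refl _) (Iso.refl _) (asIso (ρ ⊥)) (Iso.refl _) (by simp)
    (by simpa using hπ.symm) (by simp)
    ((Category.comp_id _).trans ((sq ⊥).inr_desc _ _ _).symm)

variable {P : J ⥤ C} {π : F ⟶ P}
  (hπ : ∀ j, IsPushout (F.map (homOfLE bot_le)) (π.app ⊥) (π.app j)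
    (P.map (homOfLE (bot_le : ⊥ ≤ j))))
include hπ

lemma isPushout_app_map_of_bot {j k : J} (φ : j ⟶ k) :
    IsPushout (F.map φ) (π.app j) (π.app k) (P.map φ) := by
  refine IsPushout.of_left ?_ (π.naturality φ) (hπ j)
  rw [← F.map_comp, ← P.map_comp]
  exact hπ k

lemma isWellOrderContinuous_of_isPushout [F.IsWellOrderContinuous] :
    P.IsWellOrderContinuous where
  nonempty_isColimit m hm :=
    nonempty_isColimit_of_isPushout
      (Functor.whiskerLeft (Set.principalSegIio m).monotone.functor π)
      (b := ⟨⊥, hm.bot_lt⟩) (fun _ ↦ homOfLE bot_le) (fun _ ↦ isPushout_app_map_of_bot hπ _)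
      (F.isColimitOfIsWellOrderContinuous m hm) (θ := π.app m)
      (fun _ ↦ (π.naturality _).symm) (isPushout_app_map_of_bot hπ _)

end

lemma transfiniteCompositionsOfShape_of_isPushout {J : Type w} [LinearOrder J] [OrderBot J]
    [SuccOrder J] [WellFoundedLT J] {W : MorphismProperty C} [W.IsStableUnderCobaseChange]
    {X Y X' Y' : C} {f : X ⟶ Y} {a : X ⟶ X'} {b : Y ⟶ Y'} {f' : X' ⟶ Y'}
    (sq : IsPushout f a b f') (hf : W.transfiniteCompositionsOfShape J f)
    (h : ∀ {Z Z' : C} (g : Z ⟶ Z') (a : Z ⟶ X'), MorphismProperty.transfiniteCompositions.{w} W g →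
      ∃ (Y' : C) (b : Z' ⟶ Y') (g' : X' ⟶ Y'), IsPushout g a b g') :
    W.transfiniteCompositionsOfShape J f' := by
  obtain ⟨hf⟩ := hf
  have := hf.isWellOrderContinuous
  obtain ⟨P, π, e, hπ₀, hπ⟩ := exists_isPushout_functor fun j ↦ h _ (hf.isoBot.hom ≫ a)
    (MorphismProperty.transfiniteCompositionsOfShape_le_transfiniteCompositions _ _ _
      (hf.iic j).mem)
  have sq_bot : IsPushout (hf.incl.app ⊥) (π.app ⊥) b (e.inv ≫ f') :=
    sq.of_iso hf.isoBot.symm (Iso.refl _) e (Iso.refl _) (by simp) (by simp [hπ₀])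
      (by simp) (by simp)
  let d : Cocone P :=
    { pt := Y'
      ι := { app j := (hπ j).desc (hf.incl.app j ≫ b) (e.inv ≫ f') (by simpa using sq_bot.w)
             naturality j k φ := (hπ j).hom_ext (by simp [← π.naturality_assoc])
               (by rw [← P.map_comp_assoc]; exact ((hπ k).inr_desc _ _ _).trans (by simp)) } }
  have hd_bot : P.map (homOfLE bot_le) ≫ d.ι.app ⊥ = e.inv ≫ f' := (hπ ⊥).inr_desc _ _ _
  rw [d.w] at hd_bot
  have hd : Nonempty (IsColimit d) :=
    nonempty_isColimit_of_isPushout π (b := ⊥) (fun _ ↦ homOfLE bot_le)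
      (fun _ ↦ isPushout_app_map_of_bot hπ _) hf.isColimit (θ := b)
      (fun j ↦ (hπ j).inl_desc _ _ _) (hd_bot ▸ sq_bot)
  exact ⟨{
    F := P
    isWellOrderContinuous := isWellOrderContinuous_of_isPushout hπ
    isoBot := e.symm
    incl := d.ι
    isColimit := hd.some
    fac := by simp [hd_bot]
    map_mem j hj := W.of_isPushout (isPushout_app_map_of_bot hπ _).flip (hf.map_mem j hj) }⟩

end CobaseChange

namespace ExactStructure

variable {C : Type u} [Category.{v} C] [Preadditive C] [HasZeroObject C] [HasFiniteBiproducts C]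
  {E : ExactStructure C}

lemma IsConflation.isPushout {X Y Z : C} {f : X ⟶ Y} {g : Y ⟶ Z} (h : E.IsConflation f g) :
    IsPushout f 0 g (0 : (0 : C) ⟶ Z) := by
  have := h.epi
  refine IsPushout.of_isColimit' ⟨by simp [h.zero]⟩ (PushoutCocone.IsColimit.mk _
    (fun s ↦ (h.exists_desc s.inl (by simp [s.condition])).choose)
    (fun s ↦ (h.exists_desc s.inl (by simp [s.condition])).choose_spec)
    (fun s ↦ (isZero_zero C).eq_of_src _ _) fun s m hm _ ↦ ?_)
  rw [← cancel_epi g, hm]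
  exact (h.exists_desc s.inl (by simp [s.condition])).choose_spec.symm

lemma cellComplexes_of_isConflation {I : MorphismProperty C}
    (hI : relativeCellComplexes I ≤ E.inflations) {A T B : C} {f : A ⟶ T} {g : T ⟶ B}
    (h : E.IsConflation f g) (hf : relativeCellComplexes I f) : cellComplexes I B := by
  obtain ⟨J, _, _, _, _, hf⟩ := (MorphismProperty.transfiniteCompositions_iff _ _).1 hf
  exact MorphismProperty.transfiniteCompositionsOfShape_le_transfiniteCompositions _ J _
    (transfiniteCompositionsOfShape_of_isPushout h.isPushout hf
      fun _ a hg ↦ exists_isPushout (hI _ hg) a)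

end ExactStructure

section LexicographicSums

variable {J : Type*} {Q : J → Type*}

/-- The element `k` of the `j`-th summand of a lexicographic sum of ordered types. -/
def lexMk (j : J) (k : Q j) : Σₗ j, Q j := toLex ⟨j, k⟩

lemma exists_eq_lexMk (x : Σₗ j, Q j) : ∃ (j : J) (k : Q j), x = lexMk j k := ⟨_, _, rfl⟩

variable [LinearOrder J] [∀ j, LinearOrder (Q j)]

lemma lexMk_lt_lexMk_of_lt {j j' : J} (h : j < j') (k : Q j) (k' : Q j') :
    lexMk j k < lexMk j' k' :=
  Sigma.Lex.left _ _ h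

lemma lexMk_strictMono (j : J) : StrictMono (lexMk (Q := Q) j) := fun _ _ h ↦
  Sigma.Lex.right _ _ h

lemma lexMk_lt_lexMk_iff {j : J} {k k' : Q j} : lexMk j k < lexMk j k' ↔ k < k' :=
  (lexMk_strictMono j).lt_iff_lt

lemma lexMk_le_lexMk_iff {j : J} {k k' : Q j} : lexMk j k ≤ lexMk j k' ↔ k ≤ k' :=
  (lexMk_strictMono j).le_iff_le

lemma le_of_lexMk_le_lexMk {j j' : J} {k : Q j} {k' : Q j'} (h : lexMk j k ≤ lexMk j' k') :
    j ≤ j' := by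
  by_contra h'
  exact (lexMk_lt_lexMk_of_lt (not_le.1 h') k' k).not_ge h

lemma lexMk_bot_strictMono [∀ j, OrderBot (Q j)] : StrictMono fun j ↦ lexMk j (⊥ : Q j) :=
  fun _ _ h ↦ lexMk_lt_lexMk_of_lt h _ _

instance [WellFoundedLT J] [∀ j, WellFoundedLT (Q j)] : WellFoundedLT (Σₗ j, Q j) where
  wf := ⟨fun x ↦ by
    obtain ⟨j, k, rfl⟩ := exists_eq_lexMk x
    induction j using WellFoundedLT.induction with | _ j hj
    induction k using WellFoundedLT.induction with | _ k hk
    refine ⟨_, fun y hy ↦ ?_⟩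
    obtain ⟨j', k', rfl⟩ := exists_eq_lexMk y
    obtain h | rfl := (le_of_lexMk_le_lexMk hy.le).lt_or_eq
    · exact hj _ h _
    · exact hk _ (lexMk_lt_lexMk_iff.1 hy)⟩

lemma lexMk_covBy_lexMk {j : J} {k k' : Q j} (h : k ⋖ k') : lexMk j k ⋖ lexMk j k' := by
  refine ⟨lexMk_lt_lexMk_iff.2 h.1, fun c hc hc' ↦ ?_⟩
  obtain ⟨i, l, rfl⟩ := exists_eq_lexMk c
  obtain rfl := le_antisymm (le_of_lexMk_le_lexMk hc.le) (le_of_lexMk_le_lexMk hc'.le)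
  exact h.2 (lexMk_lt_lexMk_iff.1 hc) (lexMk_lt_lexMk_iff.1 hc')

lemma exists_eq_lexMk_of_covBy [∀ j, NoMaxOrder (Q j)] {x y : Σₗ j, Q j} (h : x ⋖ y) :
    ∃ (j : J) (k k' : Q j), x = lexMk j k ∧ y = lexMk j k' ∧ k ⋖ k' := by
  obtain ⟨j, k, rfl⟩ := exists_eq_lexMk x
  obtain ⟨j', k', rfl⟩ := exists_eq_lexMk y
  obtain hj | rfl := (le_of_lexMk_le_lexMk h.le).lt_or_eq
  · obtain ⟨l, hl⟩ := exists_gt k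
    exact (h.2 (lexMk_lt_lexMk_iff.2 hl) (lexMk_lt_lexMk_of_lt hj _ _)).elim
  · exact ⟨j, k, k', rfl, rfl, lexMk_lt_lexMk_iff.1 h.1,
      fun l hl hl' ↦ h.2 (lexMk_lt_lexMk_iff.2 hl) (lexMk_lt_lexMk_iff.2 hl')⟩

lemma isSuccLimit_lexMk_cases [SuccOrder J] [∀ j, OrderBot (Q j)]
    {m : Σₗ j, Q j} (hm : Order.IsSuccLimit m) :
    (∃ (j : J) (k : Q j), m = lexMk j k ∧ Order.IsSuccLimit k) ∨
      (∃ j : J, m = lexMk j ⊥ ∧ Order.IsSuccLimit j) ∨ ∃ j : J, m = lexMk (Order.succ j) ⊥ := by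
  obtain ⟨j, k, rfl⟩ := exists_eq_lexMk m
  obtain rfl | hk := eq_or_ne k ⊥
  · obtain hj | hj := em (Order.IsSuccPrelimit j)
    · refine Or.inr (Or.inl ⟨j, rfl, fun hj' ↦ hm.1 fun y hy ↦ ?_, hj⟩)
      obtain ⟨i, l, rfl⟩ := exists_eq_lexMk y
      obtain rfl := (le_of_lexMk_le_lexMk hy).antisymm (hj' (le_of_lexMk_le_lexMk hy))
      exact lexMk_le_lexMk_iff.2 bot_le
    · obtain ⟨i, hi⟩ := Order.not_isSuccPrelimit_iff.1 hj
      exact Or.inr (Or.inr ⟨i, by rw [hi.succ_eq]⟩)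
  · exact Or.inl ⟨j, k, rfl, fun h ↦ hk h.eq_bot, fun l hl ↦ hm.2 _ (lexMk_covBy_lexMk hl)⟩

end LexicographicSums

section Flattening

variable {D : Type*} [Category* D]

lemma nonempty_isColimit_cocone_of_cofinal {A K : Type*} [LinearOrder A] [LinearOrder K]
    {F : A ⥤ D} {c : Cocone F} (hc : IsColimit c) {H : K ⥤ D} {m : K} {φ : A → K}
    (hφ : Monotone φ) (hφm : ∀ a, φ a < m) (hcof : ∀ x < m, ∃ a, x ≤ φ a)
    (e : F ≅ hφ.functor ⋙ H) (e' : c.pt ≅ H.obj m)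
    (he : ∀ a, e.hom.app a ≫ H.map (homOfLE (hφm a).le) = c.ι.app a ≫ e'.hom) :
    Nonempty (IsColimit ((Set.principalSegIio m).cocone H)) := by
  let ψ : A → Set.Iio m := fun a ↦ ⟨φ a, hφm a⟩
  have hψ : Monotone ψ := fun _ _ h ↦ hφ h
  have : hψ.functor.Final := (Monotone.final_functor_iff hψ).2 fun x ↦ hcof x x.2
  exact ⟨Functor.Final.isColimitWhiskerEquiv hψ.functor _
    ((IsColimit.precomposeHomEquiv e _).1 (IsColimit.ofIsoColimit hc (Cocone.ext e' fun a ↦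
      (he a).symm)))⟩

variable {J : Type*} [LinearOrder J] [SuccOrder J] {G : J ⥤ D} {W : MorphismProperty D}
  {Q : J → Type*} [∀ j, LinearOrder (Q j)] [∀ j, OrderBot (Q j)] [∀ j, SuccOrder (Q j)]
  [∀ j, WellFoundedLT (Q j)]
  (s : ∀ j, W.TransfiniteCompositionOfShape (Q j) (G.map (homOfLE (Order.le_succ j))))

/-- The morphism between terms of two transfinite compositions `s j` and `s j'` with `j < j'`; it
factors through `G.obj (Order.succ j)`. -/
def flattenTrans {j j' : J} (h : j < j') (k : Q j) (k' : Q j') :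
    (s j).F.obj k ⟶ (s j').F.obj k' :=
  (s j).incl.app k ≫ G.map (homOfLE (Order.succ_le_of_lt h)) ≫ (s j').isoBot.inv ≫
    (s j').F.map (homOfLE bot_le)

lemma map_flattenTrans {j j' : J} (h : j < j') {k l : Q j} (φ : k ⟶ l) (k' : Q j') :
    (s j).F.map φ ≫ flattenTrans s h l k' = flattenTrans s h k k' := by
  simp [flattenTrans]

lemma flattenTrans_map {j j' : J} (h : j < j') (k : Q j) {k' l' : Q j'} (φ : k' ⟶ l') :
    flattenTrans s h k k' ≫ (s j').F.map φ = flattenTrans s h k l' := by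
  simp [flattenTrans, ← Functor.map_comp, Subsingleton.elim (homOfLE _ ≫ φ) (homOfLE bot_le)]

lemma flattenTrans_flattenTrans {j j' j'' : J} (h : j < j') (h' : j' < j'') (k : Q j) (k' : Q j')
    (k'' : Q j'') :
    flattenTrans s h k k' ≫ flattenTrans s h' k' k'' = flattenTrans s (h.trans h') k k'' := by
  have hj' : G.map (homOfLE (Order.succ_le_of_lt (h.trans h'))) =
      G.map (homOfLE (Order.succ_le_of_lt h)) ≫ G.map (homOfLE (Order.le_succ j')) ≫
        G.map (homOfLE (Order.succ_le_of_lt h')) := by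
    simp only [← G.map_comp]; rfl
  simp [flattenTrans, hj', (s j').fac_assoc]

lemma isoBot_inv_flattenTrans {j j' : J} (h : j < j') :
    (s j).isoBot.inv ≫ flattenTrans s h ⊥ ⊥ = G.map (homOfLE h.le) ≫ (s j').isoBot.inv := by
  have hG : G.map (homOfLE h.le) = G.map (homOfLE (Order.le_succ j)) ≫
      G.map (homOfLE (Order.succ_le_of_lt h)) := by
    rw [← G.map_comp]; rfl
  simp [flattenTrans, hG]

lemma flattenTrans_lt_succ [NoMaxOrder J] (j : J) (k : Q j) :
    flattenTrans s (Order.lt_succ j) k ⊥ = (s j).incl.app k ≫ (s (Order.succ j)).isoBot.inv := by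
  simp [flattenTrans]

open Classical in
/-- The action on morphisms of `flatten`. -/
noncomputable def flattenMap : ∀ x y : Σ j, Q j, toLex x ≤ toLex y →
    ((s x.1).F.obj x.2 ⟶ (s y.1).F.obj y.2)
  | ⟨j, k⟩, ⟨j', k'⟩, h =>
    if e : j = j' then by
      subst e
      exact (s j).F.map (homOfLE (lexMk_le_lexMk_iff.1 h))
    else flattenTrans s (lt_of_le_of_ne (le_of_lexMk_le_lexMk h) e) k k'

lemma flattenMap_of_le {j : J} {k k' : Q j} (h : k ≤ k') :
    flattenMap s ⟨j, k⟩ ⟨j, k'⟩ (lexMk_le_lexMk_iff.2 h) = (s j).F.map (homOfLE h) := by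
  simp [flattenMap]

lemma flattenMap_of_lt {j j' : J} (h : j < j') (k : Q j) (k' : Q j') :
    flattenMap s ⟨j, k⟩ ⟨j', k'⟩ (lexMk_lt_lexMk_of_lt h k k').le = flattenTrans s h k k' := by
  simp [flattenMap, h.ne]

lemma flattenMap_flattenMap {j j' j'' : J} {k : Q j} {k' : Q j'} {k'' : Q j''}
    (h : lexMk j k ≤ lexMk j' k') (h' : lexMk j' k' ≤ lexMk j'' k'') :
    flattenMap s ⟨j, k⟩ ⟨j', k'⟩ h ≫ flattenMap s ⟨j', k'⟩ ⟨j'', k''⟩ h' =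
      flattenMap s ⟨j, k⟩ ⟨j'', k''⟩ (h.trans h') := by
  obtain hj | rfl := (le_of_lexMk_le_lexMk h).lt_or_eq <;>
    obtain hj' | rfl := (le_of_lexMk_le_lexMk h').lt_or_eq
  · rw [flattenMap_of_lt s hj, flattenMap_of_lt s hj', flattenMap_of_lt s (hj.trans hj'),
      flattenTrans_flattenTrans]
  · rw [flattenMap_of_lt s hj, flattenMap_of_le s (lexMk_le_lexMk_iff.1 h'),
      flattenMap_of_lt s hj, flattenTrans_map]
  · rw [flattenMap_of_le s (lexMk_le_lexMk_iff.1 h), flattenMap_of_lt s hj',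
      flattenMap_of_lt s hj', map_flattenTrans]
  · have hk := lexMk_le_lexMk_iff.1 h
    have hk' := lexMk_le_lexMk_iff.1 h'
    rw [flattenMap_of_le s hk, flattenMap_of_le s hk', flattenMap_of_le s (hk.trans hk'),
      ← Functor.map_comp]
    rfl

/-- The refinement of `G` obtained by replacing each `G.obj j ⟶ G.obj (Order.succ j)` by the
transfinite composition `s j`. -/
noncomputable def flatten : (Σₗ j, Q j) ⥤ D where
  obj x := (s (ofLex x).1).F.obj (ofLex x).2
  map {x y} φ := flattenMap s (ofLex x) (ofLex y) (leOfHom φ)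
  map_id := fun ⟨j, _⟩ ↦ (flattenMap_of_le s le_rfl).trans ((s j).F.map_id _)
  map_comp φ ψ := (flattenMap_flattenMap s (leOfHom φ) (leOfHom ψ)).symm

/-- The restriction of `flatten s` to the `j`-th summand. -/
noncomputable def isoFlatten (j : J) :
    (s j).F ≅ (lexMk_strictMono j).monotone.functor ⋙ flatten s :=
  NatIso.ofComponents (fun _ ↦ Iso.refl _) fun φ ↦
    (Category.comp_id _).trans ((flattenMap_of_le s (leOfHom φ)).symm.trans
      (Category.id_comp _).symm)

/-- The restriction of `flatten s` to the least elements of the summands. -/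
noncomputable def baseIsoFlatten : G ≅ lexMk_bot_strictMono.monotone.functor ⋙ flatten s :=
  NatIso.ofComponents (fun j ↦ (s j).isoBot.symm) fun {j j'} φ ↦ by
    obtain h | rfl := (leOfHom φ).lt_or_eq
    · exact (isoBot_inv_flattenTrans s h).symm.trans
        (congrArg ((s j).isoBot.inv ≫ ·) (flattenMap_of_lt s h ⊥ ⊥).symm)
    · obtain rfl := Subsingleton.elim φ (𝟙 j)
      rw [CategoryTheory.Functor.map_id, CategoryTheory.Functor.map_id, Category.id_comp]
      exact (Category.comp_id _).symm

lemma isoFlatten_hom_app_comp_map [NoMaxOrder J] (j : J) (k : Q j) :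
    (isoFlatten s j).hom.app k ≫
      (flatten s).map (homOfLE (lexMk_lt_lexMk_of_lt (Order.lt_succ j) k ⊥).le) =
    (s j).incl.app k ≫ (baseIsoFlatten s).hom.app (Order.succ j) :=
  (Category.id_comp _).trans ((flattenMap_of_lt s (Order.lt_succ j) k ⊥).trans
    (flattenTrans_lt_succ s j k))

instance isWellOrderContinuous_flatten [NoMaxOrder J] [G.IsWellOrderContinuous] :
    (flatten s).IsWellOrderContinuous where
  nonempty_isColimit m hm := by
    obtain ⟨j, k, rfl, hk⟩ | ⟨j, rfl, hj⟩ | ⟨j, rfl⟩ := isSuccLimit_lexMk_cases hm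
    · have := (s j).isWellOrderContinuous
      refine nonempty_isColimit_cocone_of_cofinal
        ((s j).F.isColimitOfIsWellOrderContinuous k hk) (φ := fun l ↦ lexMk j l)
        (fun _ _ h ↦ lexMk_le_lexMk_iff.2 h) (fun l ↦ lexMk_lt_lexMk_iff.2 l.2) ?_
        (Functor.isoWhiskerLeft _ (isoFlatten s j)) ((isoFlatten s j).app k)
        (fun l ↦ ((isoFlatten s j).hom.naturality _).symm)
      intro x hx
      obtain ⟨i, l, rfl⟩ := exists_eq_lexMk x
      obtain h | rfl := (le_of_lexMk_le_lexMk hx.le).lt_or_eq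
      · exact ⟨⟨⊥, hk.bot_lt⟩, (lexMk_lt_lexMk_of_lt h _ _).le⟩
      · exact ⟨⟨l, lexMk_lt_lexMk_iff.1 hx⟩, le_rfl⟩
    · refine nonempty_isColimit_cocone_of_cofinal
        (G.isColimitOfIsWellOrderContinuous j hj) (φ := fun i ↦ lexMk i ⊥)
        (fun _ _ h ↦ lexMk_bot_strictMono.monotone h) (fun i ↦ lexMk_lt_lexMk_of_lt i.2 _ _) ?_
        (Functor.isoWhiskerLeft _ (baseIsoFlatten s)) ((baseIsoFlatten s).app j)
        (fun i ↦ ((baseIsoFlatten s).hom.naturality _).symm)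
      intro x hx
      obtain ⟨i, l, rfl⟩ := exists_eq_lexMk x
      obtain h | rfl := (le_of_lexMk_le_lexMk hx.le).lt_or_eq
      · exact ⟨⟨Order.succ i, hj.succ_lt h⟩, (lexMk_lt_lexMk_of_lt (Order.lt_succ i) _ _).le⟩
      · exact (not_lt_bot (lexMk_lt_lexMk_iff.1 hx)).elim
    · refine nonempty_isColimit_cocone_of_cofinal (s j).isColimit
        (lexMk_strictMono j).monotone (fun k ↦ lexMk_lt_lexMk_of_lt (Order.lt_succ j) _ _) ?_
        (isoFlatten s j) ((baseIsoFlatten s).app (Order.succ j)) (isoFlatten_hom_app_comp_map s j)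
      intro x hx
      obtain ⟨i, l, rfl⟩ := exists_eq_lexMk x
      obtain h | rfl := (le_of_lexMk_le_lexMk hx.le).lt_or_eq
      · obtain h | rfl := (Order.le_of_lt_succ h).lt_or_eq
        · exact ⟨⊥, (lexMk_lt_lexMk_of_lt h _ _).le⟩
        · exact ⟨l, le_rfl⟩
      · exact (not_lt_bot (lexMk_lt_lexMk_iff.1 hx)).elim

lemma flatten_map_mem_of_covBy [W.RespectsIso] [∀ j, NoMaxOrder (Q j)] {x y : Σₗ j, Q j}
    (h : x ⋖ y) : W ((flatten s).map (homOfLE h.le)) := by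
  obtain ⟨j, k, k', rfl, rfl, hk⟩ := exists_eq_lexMk_of_covBy h
  obtain rfl := hk.succ_eq
  exact (W.arrow_mk_iso_iff (Arrow.isoMk ((isoFlatten s j).app k) ((isoFlatten s j).app _)
    ((isoFlatten s j).hom.naturality (homOfLE hk.le)).symm)).1 ((s j).map_mem k hk.lt.not_isMax)

end Flattening

section EssentialImage

/-- The transfinite compositions of morphisms in `W` exist. -/
def HasTransfiniteCompositions {C : Type u} [Category.{v} C] (W : MorphismProperty C) : Prop :=
  ∀ (J : Type v) [LinearOrder J] [OrderBot J] [SuccOrder J] [WellFoundedLT J] (F : J ⥤ C),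
    IsSequenceOfMorphisms W F → HasColimit F

variable {C : Type u} [Category.{v} C] {D : Type u'} [Category.{v'} D] (ι : C ⥤ D)
  (I : MorphismProperty C)

/-- The morphisms of `D` that are pushouts of images of morphisms in `I` as soon as their source is
in the essential image of `ι`. Imposing nothing on the other objects allows to iterate
constructions that are only available on the essential image. -/
def pushoutsOnEssImage : MorphismProperty D :=
  fun X _ f ↦ ι.essImage X → (I.strictMap ι).pushouts f

instance : (pushoutsOnEssImage ι I).RespectsIso :=
  MorphismProperty.RespectsIso.of_respects_arrow_iso _ fun _ _ e hf hX ↦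
    (MorphismProperty.arrow_mk_iso_iff _ e).1
      (hf (Functor.essImage.ofIso (Arrow.leftFunc.mapIso e).symm hX))

variable {ι I} [ι.Full] [ι.Faithful]

lemma isWellOrderContinuous_of_comp_fullyFaithful {K : Type*} [PartialOrder K] {F : K ⥤ C}
    [(F ⋙ ι).IsWellOrderContinuous] : F.IsWellOrderContinuous where
  nonempty_isColimit m hm :=
    ⟨isColimitOfReflects ι ((F ⋙ ι).isColimitOfIsWellOrderContinuous m hm)⟩

lemma pushouts_of_map_mem_pushouts {X Y : C} {f : X ⟶ Y}
    (hf : (I.strictMap ι).pushouts (ι.map f)) : I.pushouts f := by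
  obtain ⟨_, _, _, a, b, @⟨A, B, i, hi⟩, sq⟩ := hf
  obtain ⟨a, rfl⟩ := ι.map_surjective a
  obtain ⟨b, rfl⟩ := ι.map_surjective b
  exact ⟨A, B, i, a, b, hi, sq.of_map ι (ι.map_injective (by simpa using sq.w))⟩

omit [ι.Faithful] in
lemma essImage_of_pushouts [PreservesColimitsOfShape WalkingSpan ι]
    (hpush : ∀ {A B X : C} (i : A ⟶ B) (a : A ⟶ X), I i → HasPushout i a) {X Y : D} {f : X ⟶ Y}
    (hf : (I.strictMap ι).pushouts f) (hX : ι.essImage X) : ι.essImage Y := by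
  obtain ⟨_, _, _, a, b, @⟨A, B, i, hi⟩, sq⟩ := hf
  obtain ⟨X', ⟨e⟩⟩ := hX
  obtain ⟨a', ha'⟩ := ι.map_surjective (a ≫ e.inv)
  have := hpush i a' hi
  have sq' : IsPushout (ι.map i) a (ι.map (pushout.inl i a')) (e.inv ≫ ι.map (pushout.inr i a')) :=
    ((IsPushout.of_hasPushout i a').map ι).of_iso (Iso.refl _) (Iso.refl _) e (Iso.refl _)
      (by simp) (by simp [ha']) (by simp) (by simp)
  exact ⟨_, ⟨sq'.isoIsPushout _ _ sq.flip⟩⟩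

section

variable {K : Type v} [LinearOrder K] [OrderBot K] [SuccOrder K] [WellFoundedLT K] {F : K ⥤ D}
  [F.IsWellOrderContinuous]
  (hF : ∀ {a b : K} (h : a ⋖ b), pushoutsOnEssImage ι I (F.map (homOfLE h.le)))
include hF

lemma isSequenceOfMorphisms_liftFunctor (hess : ∀ k, ι.essImage (F.obj k)) :
    IsSequenceOfMorphisms I.pushouts (Functor.essImage.liftFunctor F ι hess) where
  isWellOrderContinuous :=
    have : (Functor.essImage.liftFunctor F ι hess ⋙ ι).IsWellOrderContinuous :=
      Functor.isWellOrderContinuous_of_iso (Functor.essImage.liftFunctorCompIso F ι hess).symm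
    isWellOrderContinuous_of_comp_fullyFaithful (ι := ι)
  map_mem j hj := pushouts_of_map_mem_pushouts <|
    (MorphismProperty.arrow_mk_iso_iff (I.strictMap ι).pushouts
      (((Functor.mapArrowFunctor _ _).mapIso (Functor.essImage.liftFunctorCompIso F ι hess)).app
        (Arrow.mk (homOfLE (Order.le_succ j))))).2
      (hF (Order.covBy_succ_of_not_isMax hj) (hess j))

lemma essImage_of_isWellOrderContinuous [PreservesColimitsOfSize.{v, v} ι]
    [PreservesColimitsOfShape WalkingSpan ι]
    (hpush : ∀ {A B X : C} (i : A ⟶ B) (a : A ⟶ X), I i → HasPushout i a)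
    (hcomp : HasTransfiniteCompositions I.pushouts)
    (hF₀ : ι.essImage (F.obj ⊥)) (k : K) : ι.essImage (F.obj k) := by
  induction k using SuccOrder.limitRecOn with
  | isMin k hk => exact hk.eq_bot ▸ hF₀
  | succ k hk ih => exact essImage_of_pushouts hpush (hF (Order.covBy_succ_of_not_isMax hk) ih) ih
  | isSuccLimit m hm ih =>
    let : OrderBot (Set.Iio m) := { bot := ⟨⊥, hm.bot_lt⟩, bot_le := fun _ ↦ bot_le }
    let : SuccOrder (Set.Iio m) := SuccOrder.ofLinearWellFoundedLT _
    let F' : Set.Iio m ⥤ D := (Set.principalSegIio m).monotone.functor ⋙ F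
    have : F'.IsWellOrderContinuous :=
      inferInstanceAs (((Set.principalSegIio m : Set.Iio m ≤i K).monotone.functor ⋙
        F).IsWellOrderContinuous)
    have hF' : ∀ {a b : Set.Iio m} (h : a ⋖ b), pushoutsOnEssImage ι I (F'.map (homOfLE h.le)) :=
      fun {a b} h ↦ hF (a := a.1) (b := b.1)
        ⟨h.1, fun c hc hc' ↦ h.2 (c := ⟨c, hc'.trans b.2⟩) hc hc'⟩
    have hess (k : Set.Iio m) : ι.essImage (F'.obj k) := ih k.1 k.2
    have := hcomp _ _ (isSequenceOfMorphisms_liftFunctor hF' hess)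
    exact ⟨_, ⟨IsColimit.coconePointsIsoOfNatIso
      (isColimitOfPreserves ι (colimit.isColimit (Functor.essImage.liftFunctor F' ι hess)))
      (F.isColimitOfIsWellOrderContinuous m hm) (Functor.essImage.liftFunctorCompIso F' ι hess)⟩⟩

end

end EssentialImage

section Attachments

variable {D : Type u} [Category.{v} D] {X : D} {Q : Type w} {A B : Q → D}
  (i : ∀ s, A s ⟶ B s) (g : ∀ s, A s ⟶ X)

/-- The objects `Φ.obj U` obtained from `X` by attaching the cells `i s` along `g s` for all `s` in
a set `U`, functorially in `U`: the morphism `x U` is the inclusion of `X` and `y s hs` that of the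
cell `B s`, and `exists_desc` and `hom_ext` are the universal property. -/
structure Attachments where
  Φ : Set Q ⥤ D
  x (U : Set Q) : X ⟶ Φ.obj U
  y {U : Set Q} (s : Q) (hs : s ∈ U) : B s ⟶ Φ.obj U
  w {U : Set Q} (s : Q) (hs : s ∈ U) : g s ≫ x U = i s ≫ y s hs
  x_map {U V : Set Q} (φ : U ⟶ V) : x U ≫ Φ.map φ = x V
  y_map {U V : Set Q} (φ : U ⟶ V) (s : Q) (hs : s ∈ U) :
    y s hs ≫ Φ.map φ = y s (leOfHom φ hs)
  exists_desc {U : Set Q} {Z : D} (x' : X ⟶ Z) (y' : ∀ s ∈ U, B s ⟶ Z) :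
    (∀ s hs, g s ≫ x' = i s ≫ y' s hs) →
      ∃ h : Φ.obj U ⟶ Z, x U ≫ h = x' ∧ ∀ s hs, y s hs ≫ h = y' s hs
  hom_ext {U : Set Q} {Z : D} {h h' : Φ.obj U ⟶ Z} :
    x U ≫ h = x U ≫ h' → (∀ s (hs : s ∈ U), y s hs ≫ h = y s hs ≫ h') → h = h'

lemma exists_attachment [HasCoproducts.{w} D] [HasPushouts D] (U : Set Q) :
    ∃ (P : D) (x : X ⟶ P) (y : ∀ s ∈ U, B s ⟶ P), (∀ s hs, g s ≫ x = i s ≫ y s hs) ∧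
      (∀ (Z : D) (x' : X ⟶ Z) (y' : ∀ s ∈ U, B s ⟶ Z), (∀ s hs, g s ≫ x' = i s ≫ y' s hs) →
        ∃ h : P ⟶ Z, x ≫ h = x' ∧ ∀ s hs, y s hs ≫ h = y' s hs) ∧
      ∀ (Z : D) (h h' : P ⟶ Z), x ≫ h = x ≫ h' →
        (∀ s hs, y s hs ≫ h = y s hs ≫ h') → h = h' := by
  let a : (∐ fun s : U ↦ A s) ⟶ ∐ fun s : U ↦ B s := Limits.Sigma.map fun s ↦ i s
  let b : (∐ fun s : U ↦ A s) ⟶ X := Limits.Sigma.desc fun s ↦ g s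
  refine ⟨pushout a b, pushout.inr a b, fun s hs ↦ Sigma.ι (fun s : U ↦ B s) ⟨s, hs⟩ ≫
    pushout.inl a b, fun s hs ↦ ?_, fun Z x' y' h ↦ ?_, fun Z h h' hx hy ↦ ?_⟩
  · simpa [a, b] using
      (Sigma.ι (fun s : U ↦ A s) ⟨s, hs⟩ ≫= pushout.condition (f := a) (g := b)).symm
  · have w : a ≫ Limits.Sigma.desc (fun s ↦ y' s.1 s.2) = b ≫ x' := by
      ext ⟨s, hs⟩
      simp [a, b, h s hs]
    refine ⟨pushout.desc _ x' w, pushout.inr_desc _ _ _, fun s hs ↦ ?_⟩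
    rw [Category.assoc, pushout.inl_desc]
    exact Sigma.ι_desc _ (⟨s, hs⟩ : U)
  · refine pushout.hom_ext (Sigma.hom_ext _ _ fun ⟨s, hs⟩ ↦ ?_) hx
    simpa using hy s hs

lemma nonempty_attachments [HasCoproducts.{w} D] [HasPushouts D] :
    Nonempty (Attachments i g) := by
  choose P x y w desc ext using exists_attachment i g
  have hmap {U V : Set Q} (h : U ≤ V) : ∃ f : P U ⟶ P V, x U ≫ f = x V ∧
      ∀ s hs, y U s hs ≫ f = y V s (h hs) := desc U _ _ _ fun s hs ↦ w V s (h hs)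
  choose f hx hy using @hmap
  let Φ : Set Q ⥤ D :=
    { obj := P
      map φ := f (leOfHom φ)
      map_id U := ext U _ _ _ (by simp [hx]) fun s hs ↦ by simp [hy]
      map_comp φ ψ := ext _ _ _ _ (by rw [← Category.assoc, hx, hx, hx])
        fun s hs ↦ by rw [← Category.assoc, hy, hy, hy] }
  exact ⟨{
    Φ := Φ
    x := x
    y s hs := y _ s hs
    w s hs := w _ s hs
    x_map _ := hx _
    y_map _ s hs := hy _ s hs
    exists_desc := desc _ _
    hom_ext := ext _ _ _ _ }⟩

namespace Attachments

variable {i g} (T : Attachments i g)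

lemma isIso_x_empty : IsIso (T.x ∅) := by
  obtain ⟨h, hx, -⟩ := T.exists_desc (U := ∅) (𝟙 X) (fun s hs ↦ hs.elim) fun s hs ↦ hs.elim
  refine ⟨h, hx, T.hom_ext ?_ fun s hs ↦ hs.elim⟩
  rw [← Category.assoc, hx, Category.id_comp, Category.comp_id]

lemma isPushout {U V : Set Q} (φ : U ⟶ V) (s : Q) (hs : s ∈ V) (hsU : s ∉ U)
    (hV : ∀ t ∈ V, t ∈ U ∨ t = s) :
    IsPushout (i s) (g s ≫ T.x U) (T.y s hs) (T.Φ.map φ) := by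
  have hdesc (c : PushoutCocone (i s) (g s ≫ T.x U)) :
      ∃ h : T.Φ.obj V ⟶ c.pt, T.y s hs ≫ h = c.inl ∧ T.Φ.map φ ≫ h = c.inr := by
    classical
    obtain ⟨h, hx, hy⟩ := T.exists_desc (U := V) (T.x U ≫ c.inr)
      (fun t ht ↦ if h : t ∈ U then T.y t h ≫ c.inr else
        eqToHom (by rw [(hV t ht).resolve_left h]) ≫ c.inl) fun t ht ↦ by
          split_ifs with h
          · rw [reassoc_of% T.w t h]
          · obtain rfl := (hV t ht).resolve_left h
            simpa using c.condition.symm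
    refine ⟨h, by simp [hy, hsU], T.hom_ext ?_ fun t ht ↦ ?_⟩
    · rw [← Category.assoc, T.x_map, hx]
    · rw [← Category.assoc, T.y_map, hy, dif_pos ht]
  choose h hl hr using hdesc
  refine ⟨⟨?_⟩, ⟨PushoutCocone.IsColimit.mk _ h hl hr fun c m hm hm' ↦
    T.hom_ext ?_ fun t ht ↦ ?_⟩⟩
  · rw [Category.assoc, T.x_map, T.w]
  · rw [← T.x_map φ, Category.assoc, Category.assoc, hm', hr]
  · obtain ht' | rfl := hV t ht
    · rw [← T.y_map φ t ht', Category.assoc, Category.assoc, hm', hr]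
    · rw [hm, hl]

section Union

variable {K : Type*} [LinearOrder K] {U : K → Set Q} (hU : Monotone U) {V : Set Q}
  (hV : ∀ k, U k ⊆ V)

/-- The cocone formed by the attachments along an increasing family of subsets of `V`. -/
def cocone : Cocone (hU.functor ⋙ T.Φ) where
  pt := T.Φ.obj V
  ι :=
    { app k := T.Φ.map (homOfLE (hV k))
      naturality _ _ _ := (T.Φ.map_comp _ _).symm.trans (Category.comp_id _).symm }

variable [Nonempty K] (hV' : ∀ s ∈ V, ∃ k, s ∈ U k) {Z : D}
include hV'

lemma exists_desc_of_union (f : ∀ k, T.Φ.obj (U k) ⟶ Z)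
    (hf : ∀ {k k'} (h : k ≤ k'), T.Φ.map (homOfLE (hU h)) ≫ f k' = f k) :
    ∃ h : T.Φ.obj V ⟶ Z, ∀ k, T.Φ.map (homOfLE (hV k)) ≫ h = f k := by
  have hx (k k' : K) : T.x _ ≫ f k = T.x _ ≫ f k' := by
    wlog h : k ≤ k' generalizing k k'
    · exact (this k' k (le_of_not_ge h)).symm
    · rw [← hf h, ← Category.assoc, T.x_map]
  have hy {k k' : K} {s : Q} (hs : s ∈ U k) (hs' : s ∈ U k') :
      T.y s hs ≫ f k = T.y s hs' ≫ f k' := by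
    wlog h : k ≤ k' generalizing k k'
    · exact (this hs' hs (le_of_not_ge h)).symm
    · rw [← hf h, ← Category.assoc, T.y_map]
  choose k hk using hV'
  let k₀ : K := Classical.arbitrary K
  obtain ⟨h, h₁, h₂⟩ := T.exists_desc (U := V) (T.x _ ≫ f k₀)
    (fun s hs ↦ T.y s (hk s hs) ≫ f (k s hs))
    fun s hs ↦ by rw [hx k₀ (k s hs), reassoc_of% T.w s (hk s hs)]
  refine ⟨h, fun l ↦ T.hom_ext ?_ fun s hs ↦ ?_⟩
  · rw [← Category.assoc, T.x_map, h₁, hx]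
  · rw [← Category.assoc, T.y_map, h₂, hy _ hs]

omit [LinearOrder K] in
lemma hom_ext_of_union {f f' : T.Φ.obj V ⟶ Z}
    (h : ∀ k, T.Φ.map (homOfLE (hV k)) ≫ f = T.Φ.map (homOfLE (hV k)) ≫ f') : f = f' := by
  refine T.hom_ext ?_ fun s hs ↦ ?_
  · let k₀ : K := Classical.arbitrary K
    rw [← T.x_map (homOfLE (hV k₀)), Category.assoc, Category.assoc, h]
  · obtain ⟨k, hk⟩ := hV' s hs
    rw [← T.y_map (homOfLE (hV k)) s hk, Category.assoc, Category.assoc, h]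

lemma nonempty_isColimit_cocone : Nonempty (IsColimit (T.cocone hU hV)) := by
  choose h hh using fun c : Cocone (hU.functor ⋙ T.Φ) ↦
    T.exists_desc_of_union hU hV hV' (fun k ↦ c.ι.app k) fun h ↦ c.w (homOfLE h)
  exact ⟨⟨h, hh, fun c m hm ↦
    T.hom_ext_of_union hV hV' fun k ↦ (hm k).trans (hh c k).symm⟩⟩

end Union

end Attachments

end Attachments

namespace Attachments

variable {D : Type u} [Category.{v} D] {X : D} {Q : Type w} {A B : Q → D} {i : ∀ s, A s ⟶ B s}
  {g : ∀ s, A s ⟶ X} (T : Attachments i g) [LinearOrder Q] [OrderBot Q] [SuccOrder Q]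

/-- Attaching the cells indexed by a well-ordered set one after another. -/
noncomputable def transfiniteCompositionOfShape [WellFoundedLT Q] [NoMaxOrder Q] :
    (MorphismProperty.ofHoms i).pushouts.TransfiniteCompositionOfShape Q (T.x Set.univ) where
  F := monotone_Iio.functor ⋙ T.Φ
  isoBot := by
    have : IsIso (T.x (Set.Iio ⊥)) := by
      rw [Set.Iio_bot]
      exact T.isIso_x_empty
    exact (asIso (T.x (Set.Iio ⊥))).symm
  isWellOrderContinuous := ⟨fun m hm ↦ by
    have : Nonempty (Set.Iio m) := ⟨⊥, hm.bot_lt⟩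
    refine T.nonempty_isColimit_cocone (U := fun k : Set.Iio m ↦ Set.Iio k.1)
      (fun _ _ h ↦ Set.Iio_subset_Iio h) (fun k ↦ Set.Iio_subset_Iio k.2.le) fun s hs ↦ ?_
    exact ⟨⟨Order.succ s, hm.succ_lt hs⟩, Order.lt_succ s⟩⟩
  incl := (T.cocone _ fun _ ↦ Set.subset_univ _).ι
  isColimit := (T.nonempty_isColimit_cocone _ _ fun s _ ↦ ⟨Order.succ s, Order.lt_succ s⟩).some
  fac := T.x_map (homOfLE (Set.subset_univ _))
  map_mem j _ := by
    have sq := T.isPushout (homOfLE (monotone_Iio (Order.le_succ j))) j (Order.lt_succ j)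
      (lt_irrefl j) fun t ht ↦ (Order.lt_succ_iff.1 ht).lt_or_eq
    exact MorphismProperty.pushouts_mk _ sq.flip ⟨j⟩

end Attachments

section CellSteps

/-- The morphisms `t : X ⟶ Y` such that, for all `i : A ⟶ B` in `W`, every morphism `A ⟶ X` extends
along `i` after composition with `t`. -/
def extendingMorphisms {D : Type u} [Category.{v} D] (W : MorphismProperty D) :
    MorphismProperty D :=
  fun X Y t ↦ ∀ ⦃A B : D⦄ (i : A ⟶ B), W i → ∀ a : A ⟶ X, ∃ b : B ⟶ Y, i ≫ b = a ≫ t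

lemma extendingMorphisms_comp_left {D : Type u} [Category.{v} D] {W : MorphismProperty D}
    {X Y Z : D} (s : X ⟶ Y) {t : Y ⟶ Z} (ht : extendingMorphisms W t) :
    extendingMorphisms W (s ≫ t) := fun _ _ i hi a ↦ by
  simpa using ht i hi (a ≫ s)

lemma extendingMorphisms_comp_right {D : Type u} [Category.{v} D] {W : MorphismProperty D}
    {X Y Z : D} {s : X ⟶ Y} (hs : extendingMorphisms W s) (t : Y ⟶ Z) :
    extendingMorphisms W (s ≫ t) := fun _ _ i hi a ↦ by
  obtain ⟨b, hb⟩ := hs i hi a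
  exact ⟨b ≫ t, by simp [reassoc_of% hb]⟩

instance {D : Type u} [Category.{v} D] (W : MorphismProperty D) :
    (extendingMorphisms W).RespectsIso :=
  MorphismProperty.RespectsIso.mk _ (fun e _ h ↦ extendingMorphisms_comp_left e.hom h)
    fun e _ h ↦ extendingMorphisms_comp_right h e.hom

lemma extendingMorphisms_of_map {C : Type u} [Category.{v} C] {D : Type u'} [Category.{v'} D]
    {ι : C ⥤ D} [ι.Full] [ι.Faithful] {I : MorphismProperty C} {X Y : C} {t : X ⟶ Y}
    (ht : extendingMorphisms (I.strictMap ι) (ι.map t)) :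
    extendingMorphisms I t := fun _ _ i hi a ↦ by
  obtain ⟨b, hb⟩ := ht (ι.map i) ⟨hi⟩ (ι.map a)
  exact ⟨ι.preimage b, ι.map_injective (by simpa using hb)⟩

variable {C : Type u} [Category.{v} C] {D : Type u'} [Category.{v'} D] (ι : C ⥤ D)
  (I : MorphismProperty C)

/-- A transfinite composition `t : X ⟶ Y`, indexed by `Q`, of pushouts of images of morphisms in `I`
that solves all extension problems for these images in `X`. Nothing is required if `X` is not in the
essential image of `ι`. -/
structure CellStep (X : D) where
  Y : D
  t : X ⟶ Y
  Q : Type v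
  [linearOrder : LinearOrder Q]
  [orderBot : OrderBot Q]
  [succOrder : SuccOrder Q]
  [wellFoundedLT : WellFoundedLT Q]
  [noMaxOrder : NoMaxOrder Q]
  comp : (pushoutsOnEssImage ι I).TransfiniteCompositionOfShape Q t
  extending : ι.essImage X → extendingMorphisms (I.strictMap ι) t

attribute [instance] CellStep.linearOrder CellStep.orderBot CellStep.succOrder
  CellStep.wellFoundedLT CellStep.noMaxOrder

variable {ι I}

lemma nonempty_cellStep_of_not_essImage {X : D} (hX : ¬ ι.essImage X) :
    Nonempty (CellStep ι I X) := by
  let s : (pushoutsOnEssImage ι I).TransfiniteCompositionOfShape ℕ (𝟙 X) :=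
    { F := (Functor.const ℕ).obj X
      isoBot := Iso.refl X
      incl := 𝟙 _
      isColimit := isColimitConstCocone ℕ X
      map_mem _ _ h := (hX h).elim }
  exact ⟨{
    Y := X
    t := 𝟙 X
    Q := Shrink.{v} ℕ
    noMaxOrder := ⟨fun a ↦ by
      obtain ⟨n, rfl⟩ := (orderIsoShrink.{v} ℕ).surjective a
      exact ⟨_, (orderIsoShrink.{v} ℕ).strictMono n.lt_succ_self⟩⟩
    comp := s.ofOrderIso (orderIsoShrink.{v} ℕ).symm
    extending h := (hX h).elim }⟩

/-- All cells that can be attached to `X` are attached one after another, each of them countably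
many times so that there is no last one. -/
lemma nonempty_cellStep_of_essImage [ι.Full] [HasCoproducts.{v} D] [HasPushouts D]
    (hI : MorphismProperty.IsSmall.{v} I) (hI' : ∀ Z : C, ∃ (A B : C) (i : A ⟶ B) (_ : A ⟶ Z), I i)
    {X : D} (hX : ι.essImage X) : Nonempty (CellStep ι I X) := by
  obtain ⟨Z, ⟨e⟩⟩ := hX
  obtain ⟨S, A, B, i, rfl⟩ := (MorphismProperty.isSmall_iff_eq_ofHoms I).1 hI
  have : Nonempty (Σ s : S, (A s ⟶ Z)) := by
    obtain ⟨_, _, _, a, ⟨s⟩⟩ := hI' Z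
    exact ⟨s, a⟩
  obtain ⟨_, _⟩ := exists_wellFoundedLT (Σ s : S, (A s ⟶ Z))
  let Q : Type v := (Σ s : S, (A s ⟶ Z)) ×ₗ ℕ
  let : OrderBot Q := WellFoundedLT.toOrderBot Q
  let : SuccOrder Q := SuccOrder.ofLinearWellFoundedLT Q
  obtain ⟨T⟩ := nonempty_attachments (fun q : Q ↦ ι.map (i (ofLex q).1.1))
    (fun q ↦ ι.map (ofLex q).1.2 ≫ e.hom)
  have hW : (MorphismProperty.ofHoms fun q : Q ↦ ι.map (i (ofLex q).1.1)).pushouts ≤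
      pushoutsOnEssImage ι (MorphismProperty.ofHoms i) := fun _ _ _ hf _ ↦
    MorphismProperty.pushouts_monotone (by rintro _ _ _ ⟨q⟩; exact ⟨⟨(ofLex q).1.1⟩⟩) _ hf
  refine ⟨{
    Y := _
    t := T.x Set.univ
    Q := Q
    comp := T.transfiniteCompositionOfShape.ofLE hW
    extending := ?_ }⟩
  rintro - _ _ _ @⟨_, _, _, ⟨s⟩⟩ a
  obtain ⟨b, hb⟩ := ι.map_surjective (a ≫ e.inv)
  refine ⟨T.y (toLex (⟨s, b⟩, 0)) (Set.mem_univ _), ?_⟩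
  simpa [hb] using (T.w (toLex (⟨s, b⟩, 0)) (Set.mem_univ _)).symm

end CellSteps

section CellSequences

lemma cof_le_cof_sigmaLex {J : Type v} [LinearOrder J] {Q : J → Type v} [∀ j, LinearOrder (Q j)]
    [∀ j, OrderBot (Q j)] : Order.cof J ≤ Order.cof (Σₗ j, Q j) := by
  refine GaloisConnection.cof_le (f := fun j ↦ lexMk j ⊥) (g := fun x ↦ (ofLex x).1) ?_
  intro j x
  obtain ⟨i, k, rfl⟩ := exists_eq_lexMk x
  refine ⟨le_of_lexMk_le_lexMk, fun h ↦ ?_⟩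
  obtain h | rfl := lt_or_eq_of_le h
  · exact (lexMk_lt_lexMk_of_lt h _ _).le
  · exact lexMk_le_lexMk_iff.2 bot_le

variable {C : Type u} [Category.{v} C] {D : Type u'} [Category.{v'} D]
  [HasColimitsOfSize.{v, v} D] {ι : C ⥤ D} {I : MorphismProperty C}
  (step : ∀ X : D, CellStep ι I X) (X₀ : D)
  (J : Type v) [LinearOrder J] [OrderBot J] [SuccOrder J] [WellFoundedLT J]

/-- The successor structure on `D` given by the cell steps `step` and the initial object `X₀`. -/
def stepSuccStruct : SmallObject.SuccStruct D where
  X₀ := X₀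
  succ X := (step X).Y
  toSucc X := (step X).t

/-- The iteration of the cell steps, starting with `X₀`. -/
noncomputable abbrev stepIteration : J ⥤ D :=
  (stepSuccStruct step X₀).iterationFunctor J

variable {J} [NoMaxOrder J]

/-- The transition morphisms of the iteration are the cell steps. -/
noncomputable def stepIterationArrowIso (j : J) :
    Arrow.mk (step ((stepIteration step X₀ J).obj j)).t ≅
      Arrow.mk ((stepIteration step X₀ J).map (homOfLE (Order.le_succ j))) :=
  Arrow.isoMk (Iso.refl _)
    ((stepSuccStruct step X₀).iterationFunctorObjSuccIso j (not_isMax j)).symm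
    ((Category.id_comp _).trans
      ((stepSuccStruct step X₀).iterationFunctor_map_succ j (not_isMax j)))

/-- The iteration of the cell steps with each step resolved into single cell attachments. -/
noncomputable def cellSequence : (Σₗ j : J, (step ((stepIteration step X₀ J).obj j)).Q) ⥤ D :=
  flatten fun j ↦ (step _).comp.ofArrowIso (stepIterationArrowIso step X₀ j)

instance : (cellSequence step X₀ (J := J)).IsWellOrderContinuous :=
  isWellOrderContinuous_flatten _

lemma cellSequence_map_mem {a b : Σₗ j : J, (step ((stepIteration step X₀ J).obj j)).Q}
    (h : a ⋖ b) : pushoutsOnEssImage ι I ((cellSequence step X₀).map (homOfLE h.le)) :=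
  flatten_map_mem_of_covBy _ h

/-- The iteration is a subsequence of its resolution into single cell attachments. -/
noncomputable def stepIterationIso :
    stepIteration step X₀ J ≅ lexMk_bot_strictMono.monotone.functor ⋙ cellSequence step X₀ :=
  baseIsoFlatten _

lemma exists_extendingMorphisms_cellSequence
    (hess : ∀ x, ι.essImage ((cellSequence step X₀ (J := J)).obj x))
    (x : Σₗ j : J, (step ((stepIteration step X₀ J).obj j)).Q) :
    ∃ (y : _) (h : x ≤ y),
      extendingMorphisms (I.strictMap ι) ((cellSequence step X₀).map (homOfLE h)) := by
  obtain ⟨j, k, rfl⟩ := exists_eq_lexMk x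
  have hstep : extendingMorphisms (I.strictMap ι)
      ((stepIteration step X₀ J).map (homOfLE (Order.le_succ (Order.succ j)))) :=
    (MorphismProperty.arrow_mk_iso_iff _ (stepIterationArrowIso step X₀ _)).1
      ((step _).extending (Functor.essImage.ofIso ((stepIterationIso step X₀).app _).symm (hess _)))
  have hseq := (MorphismProperty.arrow_mk_iso_iff _
    (((Functor.mapArrowFunctor _ _).mapIso (stepIterationIso step X₀)).app (Arrow.mk _))).1 hstep
  have hle := (lexMk_lt_lexMk_of_lt (Q := fun j ↦ (step ((stepIteration step X₀ J).obj j)).Q)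
    (Order.lt_succ j) k ⊥).le
  have hle_succ := lexMk_bot_strictMono (Q := fun j ↦ (step ((stepIteration step X₀ J).obj j)).Q)
    |>.monotone (Order.le_succ (Order.succ j))
  refine ⟨_, hle.trans hle_succ, ?_⟩
  rw [← homOfLE_comp hle hle_succ, Functor.map_comp]
  exact extendingMorphisms_comp_left _ hseq

end CellSequences

section SmallObjectArgument

lemma exists_noMaxOrder_cof_gt (κ : Cardinal.{v}) :
    ∃ (J : Type v) (_ : LinearOrder J) (_ : OrderBot J) (_ : SuccOrder J) (_ : WellFoundedLT J)
      (_ : NoMaxOrder J), κ < Order.cof J := by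
  let c : Cardinal.{v} := Order.succ (max κ Cardinal.aleph0)
  have hc : c.IsRegular := Cardinal.isRegular_succ (le_max_right _ _)
  have : Nonempty c.ord.ToType := Ordinal.nonempty_toType_iff.2 hc.ord_pos.ne'
  refine ⟨c.ord.ToType, inferInstance, WellFoundedLT.toOrderBot _,
    SuccOrder.ofLinearWellFoundedLT _, inferInstance, Cardinal.noMaxOrder hc.aleph0_le, ?_⟩
  rw [Ordinal.cof_toType, hc.cof_ord]
  exact (le_max_left _ _).trans_lt (Order.lt_succ _)

variable {C : Type u} [Category.{v} C] {I W : MorphismProperty C}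

lemma exists_forall_isSmallRelativeWith (hI : MorphismProperty.IsSmall.{v} I)
    (hW : ∀ {X Y : C} (i : X ⟶ Y), I i → IsSmallRelative W X) :
    ∃ κ : Cardinal.{v}, ∀ {X Y : C} (i : X ⟶ Y), I i → IsSmallRelativeWith κ W X := by
  obtain ⟨S, A, B, i, rfl⟩ := (MorphismProperty.isSmall_iff_eq_ofHoms I).1 hI
  choose κ hκ using fun s ↦ hW (i s) ⟨s⟩
  refine ⟨Cardinal.sum κ, ?_⟩
  rintro _ _ _ ⟨s⟩ J _ _ _ _ F hJ hF
  exact hκ s J F ((Cardinal.le_sum κ s).trans_lt hJ) hF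

section

variable {K : Type v} [LinearOrder K] [OrderBot K] [SuccOrder K] [WellFoundedLT K] {F : K ⥤ C}
  [HasColimit F]

lemma relativeCellComplexes_hom_comp_colimit_ι (hF : IsSequenceOfMorphisms I.pushouts F) {A : C}
    (e : A ≅ F.obj ⊥) : relativeCellComplexes I (e.hom ≫ colimit.ι F ⊥) := by
  refine MorphismProperty.transfiniteCompositionsOfShape_le_transfiniteCompositions _ K _ ⟨?_⟩
  exact
    { F := F
      isoBot := e.symm
      isWellOrderContinuous := hF.isWellOrderContinuous
      incl := (colimit.cocone F).ι
      isColimit := colimit.isColimit F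
      map_mem := hF.map_mem }

omit [OrderBot K] [SuccOrder K] [WellFoundedLT K] in
lemma extendingMorphisms_id_colimit
    (hF : ∀ k, ∃ (l : K) (h : k ≤ l), extendingMorphisms I (F.map (homOfLE h)))
    (hI : ∀ {X Y : C} (i : X ⟶ Y), I i → PreservesColimit F (coyoneda.obj (Opposite.op X))) :
    extendingMorphisms I (𝟙 (colimit F)) := fun X Y i hi a ↦ by
  have := hI i hi
  obtain ⟨k, a', rfl⟩ : ∃ (k : K) (a' : X ⟶ F.obj k), a' ≫ colimit.ι F k = a :=
    Types.jointly_surjective_of_isColimit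
      (isColimitOfPreserves (coyoneda.obj (Opposite.op X)) (colimit.isColimit F)) a
  obtain ⟨l, h, hl⟩ := hF k
  simpa using extendingMorphisms_comp_right hl (colimit.ι F l) i hi a'

end

variable (hI : MorphismProperty.IsSmall.{v} I)
  (hI' : ∀ Z : C, ∃ (A B : C) (i : A ⟶ B) (_ : A ⟶ Z), I i)
  (hpush : ∀ {A B X : C} (i : A ⟶ B) (a : A ⟶ X), I i → HasPushout i a)
  (hcomp : HasTransfiniteCompositions I.pushouts)
include hI hI' hpush hcomp

lemma exists_isSequenceOfMorphisms_pushouts_extendingMorphisms (A : C)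
    (J : Type v) [LinearOrder J] [OrderBot J] [SuccOrder J] [WellFoundedLT J] [NoMaxOrder J] :
    ∃ (K : Type v) (_ : LinearOrder K) (_ : OrderBot K) (_ : SuccOrder K) (_ : WellFoundedLT K)
      (F : K ⥤ C), Nonempty (A ≅ F.obj ⊥) ∧ IsSequenceOfMorphisms I.pushouts F ∧
        Order.cof J ≤ Order.cof K ∧
        ∀ k, ∃ (l : K) (h : k ≤ l), extendingMorphisms I (F.map (homOfLE h)) := by
  -- Presheaf categories are cocomplete, and the opposite Yoneda embedding preserves colimits.
  let ι : C ⥤ (C ⥤ Type v)ᵒᵖ := coyoneda.rightOp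
  have : PreservesColimitsOfSize.{v, v} ι := ⟨preservesColimitsOfShape_rightOp _ _⟩
  have : PreservesColimitsOfShape WalkingSpan ι := preservesColimitsOfShape_rightOp _ _
  let step (X) : CellStep ι I X := Nonempty.some <| by
    by_cases hX : ι.essImage X
    · exact nonempty_cellStep_of_essImage hI hI' hX
    · exact nonempty_cellStep_of_not_essImage hX
  let H := cellSequence step (ι.obj A) (J := J)
  let : SuccOrder (Σₗ j : J, (step ((stepIteration step (ι.obj A) J).obj j)).Q) :=
    SuccOrder.ofLinearWellFoundedLT _
  have hH {a b} (h : a ⋖ b) : pushoutsOnEssImage ι I (H.map (homOfLE h.le)) :=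
    cellSequence_map_mem _ _ h
  let e₀ : ι.obj A ≅ H.obj ⊥ :=
    ((stepSuccStruct step (ι.obj A)).iterationFunctorObjBotIso J).symm ≪≫
      (stepIterationIso step (ι.obj A)).app ⊥
  have hess := essImage_of_isWellOrderContinuous hH hpush hcomp ⟨A, ⟨e₀⟩⟩
  let e := Functor.essImage.liftFunctorCompIso H ι hess
  refine ⟨_, _, _, _, inferInstance, Functor.essImage.liftFunctor H ι hess,
    ⟨ι.preimageIso (e₀ ≪≫ (e.app ⊥).symm)⟩, isSequenceOfMorphisms_liftFunctor hH hess,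
    cof_le_cof_sigmaLex, fun k ↦ ?_⟩
  obtain ⟨l, h, hl⟩ := exists_extendingMorphisms_cellSequence step (ι.obj A) hess k
  exact ⟨l, h, extendingMorphisms_of_map ((MorphismProperty.arrow_mk_iso_iff _
    (((Functor.mapArrowFunctor _ _).mapIso e).app (Arrow.mk (homOfLE h)))).2 hl)⟩

theorem exists_relativeCellComplexes_extendingMorphisms_id
    (hsmall : ∀ {X Y : C} (i : X ⟶ Y), I i → IsSmallRelative (relativeCellComplexes I) X) (A : C) :
    ∃ (T : C) (f : A ⟶ T), relativeCellComplexes I f ∧ extendingMorphisms I (𝟙 T) := by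
  obtain ⟨κ, hκ⟩ := exists_forall_isSmallRelativeWith hI hsmall
  obtain ⟨J, _, _, _, _, _, hJ⟩ := exists_noMaxOrder_cof_gt κ
  obtain ⟨K, _, _, _, _, F, ⟨e⟩, hF, hJK, hext⟩ :=
    exists_isSequenceOfMorphisms_pushouts_extendingMorphisms hI hI' hpush hcomp A J
  have := hcomp K F hF
  refine ⟨colimit F, e.hom ≫ colimit.ι F ⊥, relativeCellComplexes_hom_comp_colimit_ι hF e,
    extendingMorphisms_id_colimit hext fun i hi ↦ hκ i hi K F (hJ.trans_le hJK) ⟨?_, ?_⟩⟩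
  · exact hF.isWellOrderContinuous
  · exact fun j hj ↦ MorphismProperty.le_transfiniteCompositions _ _ (hF.map_mem j hj)

end SmallObjectArgument

section Homological

lemma rlp_zero_of_extendingMorphisms_id {C : Type u} [Category.{v} C] [HasZeroMorphisms C]
    [HasZeroObject C] {I : MorphismProperty C} {T : C} (hT : extendingMorphisms I (𝟙 T)) :
    I.rlp (0 : T ⟶ (0 : C)) := by
  intro A B i hi
  refine ⟨fun {a b} _ ↦ ?_⟩
  obtain ⟨l, hl⟩ := hT i hi a
  exact ⟨⟨l, by simpa using hl, (isZero_zero C).eq_of_tgt _ _⟩⟩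

end Homological

section RelativeCellComplexes

variable {C : Type u} [Category.{v} C] (I : MorphismProperty C)

lemma le_relativeCellComplexes : I ≤ relativeCellComplexes I :=
  I.le_pushouts.trans (MorphismProperty.le_transfiniteCompositions _)

lemma relativeCellComplexes_id (A : C) : relativeCellComplexes I (𝟙 A) :=
  MorphismProperty.transfiniteCompositionsOfShape_le_transfiniteCompositions _ _ _
    ((MorphismProperty.TransfiniteCompositionOfShape.id I.pushouts A).ofOrderIso
      (orderIsoShrink.{v} (Fin 1)).symm).mem

end RelativeCellComplexes

namespace ExactStructure

variable {C : Type u} [Category.{v} C] [Preadditive C] [HasZeroObject C] [HasFiniteBiproducts C]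
  {E : ExactStructure C} {I : MorphismProperty C}

lemma exists_relativeCellComplexes_rlp (hI : I ≤ E.inflations)
    (hI_small : MorphismProperty.IsSmall.{v} I)
    (hcomp : HasTransfiniteCompositions I.pushouts)
    (hsmall : ∀ {X Y : C} (i : X ⟶ Y), I i → IsSmallRelative (relativeCellComplexes I) X) (A : C) :
    ∃ (T : C) (f : A ⟶ T), relativeCellComplexes I f ∧ I.rlp (0 : T ⟶ (0 : C)) := by
  by_cases h : ∃ (X Y : C) (i : X ⟶ Y), I i
  · obtain ⟨X, Y, i, hi⟩ := h
    obtain ⟨T, f, hf, hT⟩ := exists_relativeCellComplexes_extendingMorphisms_id hI_small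
      (fun _ ↦ ⟨X, Y, i, 0, hi⟩)
      (fun j a hj ↦ have ⟨_, _, _, sq⟩ := exists_isPushout (hI _ hj) a; sq.hasPushout)
      hcomp hsmall A
    exact ⟨T, f, hf, rlp_zero_of_extendingMorphisms_id hT⟩
  · exact ⟨A, 𝟙 A, relativeCellComplexes_id I A, fun X Y i hi ↦ (h ⟨X, Y, i, hi⟩).elim⟩

lemma hasSpecialPreenvelopes_rightPerp_cokernelsOf (hI_small : MorphismProperty.IsSmall.{v} I)
    (hI_hom : E.IsHomological I)
    (hcomp : HasTransfiniteCompositions I.pushouts)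
    (hsmall : ∀ {X Y : C} (i : X ⟶ Y), I i → IsSmallRelative (relativeCellComplexes I) X)
    (hI_cell : relativeCellComplexes I ≤ E.inflations) :
    E.HasSpecialPreenvelopes (E.rightPerp (cokernelsOf I)) (cellComplexes I) := by
  intro A
  obtain ⟨T, f, hf, hT⟩ := exists_relativeCellComplexes_rlp
    ((le_relativeCellComplexes I).trans hI_cell) hI_small hcomp hsmall A
  obtain ⟨B, g, hfg⟩ := exists_isConflation_of_inflation (hI_cell _ hf)
  exact ⟨T, B, f, g, hfg.zero, hfg.choose_spec, hI_hom T hT,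
    cellComplexes_of_isConflation hI_cell hfg hf⟩

end ExactStructure

theorem theorem3p6_general {C : Type u} [Category.{v} C] [Preadditive C] [HasZeroObject C]
    [HasFiniteBiproducts C] (E : ExactStructure C) (I : MorphismProperty C)
    (hI_small : MorphismProperty.IsSmall.{v} I) (hI_hom : E.IsHomological I)
    (hcomp : HasTransfiniteCompositions I.pushouts)
    (hsmall : ∀ {X Y : C} (i : X ⟶ Y), I i → IsSmallRelative (relativeCellComplexes I) X)
    (hI_cell : relativeCellComplexes I ≤ E.inflations) :
    (E.HasSpecialPreenvelopes (E.rightPerp (cokernelsOf I)) (cellComplexes I) ∧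
      IsCovariantlyFinite (E.rightPerp (cokernelsOf I))) ∧
    (E.IsClassOfGenerators (cellComplexes I) →
      E.IsCompleteCotorsionPair (E.leftPerp (E.rightPerp (cokernelsOf I)))
        (E.rightPerp (cokernelsOf I))) ∧
    (E.IsClassOfGenerators (E.leftPerp (E.rightPerp (cokernelsOf I))) →
      E.HasSpecialPrecovers (E.rightPerp (cokernelsOf I))
        (E.leftPerp (E.rightPerp (cokernelsOf I))) ∧
      E.IsCompleteCotorsionPair (E.leftPerp (E.rightPerp (cokernelsOf I)))
        (E.rightPerp (cokernelsOf I))) ∧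
    (IsClosedUnderCoproducts (E.filtered (cokernelsOf I)) →
      E.IsClosedUnderExtensions (E.filtered (cokernelsOf I)) →
      E.IsClassOfGenerators (E.filtered (cokernelsOf I)) →
      ∀ A : C, E.leftPerp (E.rightPerp (cokernelsOf I)) A ↔
        IsDirectSummandOf (E.filtered (cokernelsOf I)) A) := by
  have hcell_filt : cellComplexes I ≤ E.filtered (cokernelsOf I) :=
    ExactStructure.cellComplexes_le_filtered ((le_relativeCellComplexes I).trans hI_cell)
  have hfilt := ExactStructure.filtered_le_leftPerp_rightPerp (E := E) (cokernelsOf I)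
  have hcell := ExactStructure.hasSpecialPreenvelopes_rightPerp_cokernelsOf hI_small hI_hom hcomp
    hsmall hI_cell
  have hpre := hcell.mono (hcell_filt.trans hfilt)
  have hcov (hgen : E.IsClassOfGenerators (E.leftPerp (E.rightPerp (cokernelsOf I)))) :=
    hpre.hasSpecialPrecovers (ExactStructure.isClosedUnderCoproducts_leftPerp _)
      (ExactStructure.isClosedUnderExtensions_leftPerp _) hgen
  exact ⟨⟨hcell, hpre.isCovariantlyFinite⟩,
    fun hgen ↦ hpre.isCompleteCotorsionPair (hcov (hgen.mono (hcell_filt.trans hfilt))),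
    fun hgen ↦ ⟨hcov hgen, hpre.isCompleteCotorsionPair (hcov hgen)⟩,
    fun hcoprod hext hgen ↦ ExactStructure.leftPerp_iff_isDirectSummandOf
      ((hcell.mono hcell_filt).hasSpecialPrecovers hcoprod hext hgen) hfilt⟩

theorem theorem3p6 {C : Type u} [Category.{v} C] [Preadditive C] [HasZeroObject C]
    [HasFiniteBiproducts C] (E : ExactStructure C) (I : MorphismProperty C)
    (hI_small : MorphismProperty.IsSmall.{v} I) (hI : I ≤ E.inflations)
    (hI_hom : E.IsHomological I) (hI_soa : AdmitsSmallObjectArgument I)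
    (hI_cell : relativeCellComplexes I ≤ E.inflations) :
    -- (a)
    ((∀ A : C, ∃ (T B : C) (f : A ⟶ T) (g : T ⟶ B) (w : f ≫ g = 0),
        E.conflation (ShortComplex.mk f g w) ∧
          E.rightPerp (cokernelsOf I) T ∧ cellComplexes I B) ∧
      IsCovariantlyFinite (E.rightPerp (cokernelsOf I))) ∧
    -- (b)
    (E.IsClassOfGenerators (cellComplexes I) →
      E.IsCompleteCotorsionPair (E.leftPerp (E.rightPerp (cokernelsOf I)))
        (E.rightPerp (cokernelsOf I))) ∧
    -- (c)
    (IsClosedUnderCoproducts (E.leftPerp (E.rightPerp (cokernelsOf I))) →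
      E.IsClassOfGenerators (E.leftPerp (E.rightPerp (cokernelsOf I))) →
      (∀ A : C, ∃ (T' B' : C) (f : T' ⟶ B') (g : B' ⟶ A) (w : f ≫ g = 0),
        E.conflation (ShortComplex.mk f g w) ∧ E.rightPerp (cokernelsOf I) T' ∧
          E.leftPerp (E.rightPerp (cokernelsOf I)) B') ∧
      E.IsCompleteCotorsionPair (E.leftPerp (E.rightPerp (cokernelsOf I)))
        (E.rightPerp (cokernelsOf I))) ∧
    -- (d)
    (IsClosedUnderCoproducts (E.filtered (cokernelsOf I)) →
      E.IsClosedUnderExtensions (E.filtered (cokernelsOf I)) →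
      E.IsClassOfGenerators (E.filtered (cokernelsOf I)) →
      ∀ A : C, E.leftPerp (E.rightPerp (cokernelsOf I)) A ↔
        IsDirectSummandOf (E.filtered (cokernelsOf I)) A) := by
  obtain ⟨ha, hb, hc, hd⟩ := theorem3p6_general E I hI_small hI_hom
    hI_soa.hasTransfiniteCompositions hI_soa.isSmallRelative hI_cell
  exact ⟨ha, hb, fun _ ↦ hc, hd⟩
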